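/- Let $M$ be a real random variable with a probability density $f$ that is positive on all of $\mathbb{R}$, such that $\log f$ is concave, and with $\mathbb{E}|M|<\infty$. Let $b\in\mathbb{R}$. In the quadratic cheap-talk game with bias $b$ an encoder observes $M$ and sends $X=\gamma^e(M)$, and a decoder takes the action $U=\gamma^d(X)$. The policies $\gamma^e,\gamma^d$ range over the Borel measurable functions $\mathbb{R}\to\mathbb{R}$. The encoder's cost is $J^e(\gamma^e,\gamma^d)=\mathbb{E}[(M-U-b)^2]$ and the decoder's cost is $J^d(\gamma^e,\gamma^d)=\mathbb{E}[(M-U)^2]$ (both possibly $+\infty$). A pair $(\gamma^{*,e},\gamma^{*,d})$ is a Nash equilibrium if $J^e(\gamma^{*,e},\gamma^{*,d})\le J^e(\gamma^e,\gamma^{*,d})$ and $J^d(\gamma^{*,e},\gamma^{*,d})\le J^d(\gamma^{*,e},\gamma^d)$ for all policies $\gamma^e,\gamma^d$. An equilibrium with $N$ bins consists of bin edges $-\infty=m_0<m_1<\dots<m_N=+\infty$ and actions $u_1,\dots,u_N\in\mathbb{R}$ for which there is a Nash equilibrium $(\gamma^e,\gamma^d)$ with $\gamma^e(m)=k$ for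 $m\in[m_{k-1},m_k)$ and $\gamma^d(k)=u_k$ for $k=1,\dots,N$ (where $[m_0,m_1)$ means $(-\infty,m_1)$). Then for every integer $N\ge 1$ there is exactly one equilibrium with $N$ bins (that is, the bin edges and the actions exist and are unique). Moreover, every Nash equilibrium in arbitrary policies whose decision $\gamma^d(\gamma^e(M))$ takes almost surely exactly $N$ different values, each with positive probability, leads almost surely to the same decisions as the equilibrium with $N$ bins: $\gamma^d(\gamma^e(M))=u_k$ whenever $M\in[m_{k-1},m_k)$. In particular, there is no upper bound on the number of bins at an equilibrium. -/

import Mathlib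

open MeasureTheory

namespace CheapTalk

/-- `f` is a probability density function on the real line. -/
structure IsProbabilityDensity (f : ℝ → ℝ) : Prop where
  measurable : Measurable f
  nonneg : ∀ x, 0 ≤ f x
  lintegral_eq_one : ∫⁻ x, ENNReal.ofReal (f x) = 1

/-- `log f` is concave on the support of `f` (in particular the support is convex). -/
def IsLogConcaveDensity (f : ℝ → ℝ) : Prop :=
  ConcaveOn ℝ (Function.support f) (fun x => Real.log (f x))

/-- The density has two-sided unbounded support. -/
def HasTwoSidedUnboundedSupport (f : ℝ → ℝ) : Prop :=
  Function.support f = Set.univ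

/-- The density has a finite mean. -/
def HasFiniteMean (f : ℝ → ℝ) : Prop :=
  Integrable (fun x => x * f x)

/-- The law of the source `M`. -/
noncomputable def sourceLaw (f : ℝ → ℝ) : Measure ℝ :=
  volume.withDensity (fun x => ENNReal.ofReal (f x))

/-- Expected cost of the encoder, `E[(M - U - b)²]` with `U = γd (γe M)`; it may be infinite. -/
noncomputable def encoderCost (P : Measure ℝ) (b : ℝ) (γe γd : ℝ → ℝ) : ENNReal :=
  ∫⁻ x, ENNReal.ofReal ((x - γd (γe x) - b) ^ 2) ∂P

/-- Expected cost of the decoder, `E[(M - U)²]` with `U = γd (γe M)`; it may be infinite. -/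
noncomputable def decoderCost (P : Measure ℝ) (γe γd : ℝ → ℝ) : ENNReal :=
  ∫⁻ x, ENNReal.ofReal ((x - γd (γe x)) ^ 2) ∂P

/-- Nash equilibrium of the simultaneous-move game; the policies of the encoder and of the decoder
are the deterministic Borel measurable functions from `ℝ` to `ℝ`. -/
structure IsNashEquilibrium (P : Measure ℝ) (b : ℝ) (γe γd : ℝ → ℝ) : Prop where
  measurable_encoder : Measurable γe
  measurable_decoder : Measurable γd
  encoder_optimal : ∀ γ : ℝ → ℝ, Measurable γ → encoderCost P b γe γd ≤ encoderCost P b γ γd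
  decoder_optimal : ∀ γ : ℝ → ℝ, Measurable γ → decoderCost P γe γd ≤ decoderCost P γe γ

/-- The bin number `k` (counted from `0`), i.e. the interval from `m k` (included) to `m (k + 1)`
(excluded), for bin edges `m 0, …, m N` in the extended real line. -/
def bin {N : ℕ} (m : Fin (N + 1) → EReal) (k : Fin N) : Set ℝ :=
  {x : ℝ | m k.castSucc ≤ (x : EReal) ∧ (x : EReal) < m k.succ}

/-- An equilibrium with `N` bins, described by the bin edges `-∞ = m 0 < m 1 < … < m N = +∞` and the
decoder actions `u 0, …, u (N - 1)`: there is a Nash equilibrium in which the encoder reports the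
bin that contains its observation (the bins are reported by the numbers `1, …, N`) and the decoder
answers the report of a bin by the action of that bin. -/
structure IsEquilibriumWithBins (P : Measure ℝ) (b : ℝ) {N : ℕ}
    (m : Fin (N + 1) → EReal) (u : Fin N → ℝ) : Prop where
  first_edge : m 0 = ⊥
  last_edge : m (Fin.last N) = ⊤
  strictMono_edges : StrictMono m
  exists_policies : ∃ γe γd : ℝ → ℝ, IsNashEquilibrium P b γe γd ∧
    (∀ k : Fin N, ∀ x ∈ bin m k, γe x = ((k : ℕ) : ℝ) + 1) ∧
    (∀ k : Fin N, γd (((k : ℕ) : ℝ) + 1) = u k)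

/-- The policies `γe, γd` lead, almost surely, to exactly `N` different decoder actions, each with
positive probability. (No shape is imposed on the sets on which these actions are taken.) -/
def InducesActions (P : Measure ℝ) (γe γd : ℝ → ℝ) (N : ℕ) : Prop :=
  ∃ A : Finset ℝ, A.card = N ∧ (∀ᵐ x ∂P, γd (γe x) ∈ A) ∧
    ∀ a ∈ A, 0 < P {x | γd (γe x) = a}

end CheapTalk

/-! At an equilibrium with bins the decoder answers each bin by its centroid, and the encoder is
indifferent at each inner edge `e` between the centroids `u`, `u'` of the adjacent bins: `2 (e - b)
= u + u'`. Conversely, edges satisfying these equations support an equilibrium, so the theorem is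
about existence and uniqueness of solutions (`IsBinChain`) with outer edges `-∞` and `+∞`.

Log-concavity enters through one inequality, `centroid_add_le`: moving both ends of a segment to the
right by `h ≥ 0` moves its centroid by at most `h`. Equality forces `f (x + h) = C * f x` on the
segment.

For `b ≤ 0` the chain is built by adjoining bins on the right. Let `V e` be the last action of the
chain with a given number of bins that ends at `e`. A further bin ending at `E` requires `(e - V e)
- (centroid f e E - e) = 2 b`. The left side is nondecreasing in `e`, because `V` and the centroid
grow at most as fast as the edge; a solution comes from the intermediate value theorem
(`exists_edge`). For finite `E` it is strictly increasing; for `E = +∞` two solutions would make `f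
(x + h) = C * f x` on the whole line, which integrability excludes (`le_of_edge`). The properties of
`V` that are used pass to the longer chain (`isLastAction_step`), and `binChain_aux` is the
induction. The case `b ≥ 0` follows by the reflection `x ↦ -x`, which changes the sign of `b`.

For a Nash equilibrium in arbitrary policies with finitely many actions, the encoder almost surely
obtains the action nearest to `x - b`, so these actions are taken on intervals. The decoder is
unbiased where each action is taken, hence the intervals form a chain, and uniqueness of chains
identifies it. -/

namespace CheapTalk

/-! ### Segments and the monotonicity of their centroids -/

/-- A positive log-concave weight on the line with finite second moment. -/
structure LogConcaveWeight (f : ℝ → ℝ) : Prop where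
  continuous : Continuous f
  pos : ∀ x, 0 < f x
  concave : ConcaveOn ℝ Set.univ (fun x => Real.log (f x))
  integrable : Integrable f
  integrable_mul : Integrable (fun x => x * f x)
  integrable_sq_mul : Integrable (fun x => x ^ 2 * f x)

/-- The reals between two extended reals, left end included. -/
def seg (α β : EReal) : Set ℝ := {x : ℝ | α ≤ (x : EReal) ∧ (x : EReal) < β}

/-- The centre of mass of a segment. -/
noncomputable def centroid (f : ℝ → ℝ) (α β : EReal) : ℝ :=
  (∫ x in seg α β, x * f x) / ∫ x in seg α β, f x

theorem measurableSet_seg (α β : EReal) : MeasurableSet (seg α β) :=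
  (measurableSet_le measurable_const measurable_coe_real_ereal).inter
    (measurableSet_lt measurable_coe_real_ereal measurable_const)

theorem volume_seg_pos {α β : EReal} (h : α < β) : 0 < volume (seg α β) := by
  obtain ⟨x, hx, hxβ⟩ := EReal.lt_iff_exists_real_btwn.1 h
  obtain ⟨y, hxy, hy⟩ := EReal.lt_iff_exists_real_btwn.1 hxβ
  have hsub : Set.Ioo x y ⊆ seg α β := fun z hz =>
    ⟨hx.le.trans (EReal.coe_le_coe_iff.2 hz.1.le), (EReal.coe_lt_coe_iff.2 hz.2).trans hy⟩
  refine lt_of_lt_of_le ?_ (measure_mono hsub)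
  rw [Real.volume_Ioo]
  exact ENNReal.ofReal_pos.2 (sub_pos.2 (EReal.coe_lt_coe_iff.1 hxy))

theorem setIntegral_pos_of_pos {S : Set ℝ} (hS : MeasurableSet S) (hv : 0 < volume S) {g : ℝ → ℝ}
    (hg : IntegrableOn g S) (hpos : ∀ x ∈ S, 0 < g x) : 0 < ∫ x in S, g x := by
  rw [setIntegral_pos_iff_support_of_nonneg_ae]
  · rwa [Set.inter_eq_self_of_subset_right]
    exact fun x hx => (hpos x hx).ne'
  · filter_upwards [ae_restrict_mem hS] with x hx using (hpos x hx).le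
  · exact hg

theorem seg_union {α β γ : EReal} (h₁ : α ≤ β) (h₂ : β ≤ γ) : seg α γ = seg α β ∪ seg β γ := by
  ext x
  change (α ≤ x ∧ x < γ) ↔ (α ≤ x ∧ x < β) ∨ (β ≤ x ∧ x < γ)
  constructor
  · rintro ⟨h, h'⟩
    rcases lt_or_ge (x : EReal) β with hx | hx
    · exact Or.inl ⟨h, hx⟩
    · exact Or.inr ⟨hx, h'⟩
  · rintro (⟨h, h'⟩ | ⟨h, h'⟩)
    · exact ⟨h, h'.trans_le h₂⟩
    · exact ⟨h₁.trans h, h'⟩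

theorem seg_disjoint (α β γ : EReal) : Disjoint (seg α β) (seg β γ) :=
  Set.disjoint_left.2 fun _ hx hx' => absurd hx.2 (not_lt.2 hx'.1)

namespace LogConcaveWeight

variable {f : ℝ → ℝ} (hf : LogConcaveWeight f)
include hf

theorem integrable_sub_mul (t : ℝ) : Integrable (fun x => (x - t) * f x) := by
  simp only [sub_mul]
  exact hf.integrable_mul.sub (hf.integrable.const_mul t)

theorem mass_pos {α β : EReal} (h : α < β) : 0 < ∫ x in seg α β, f x :=
  setIntegral_pos_of_pos (measurableSet_seg α β) (volume_seg_pos h) hf.integrable.integrableOn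
    fun x _ => hf.pos x

theorem setIntegral_sub_mul {α β : EReal} (h : α < β) (t : ℝ) :
    ∫ x in seg α β, (x - t) * f x = (centroid f α β - t) * ∫ x in seg α β, f x := by
  have h0 := (hf.mass_pos h).ne'
  simp only [sub_mul]
  rw [integral_sub hf.integrable_mul.integrableOn (hf.integrable.const_mul t).integrableOn,
    integral_const_mul, centroid, div_mul_cancel₀ _ h0]

theorem lt_centroid {α β : EReal} (h : α < β) {t : ℝ}
    (ht : 0 < ∫ x in seg α β, (x - t) * f x) : t < centroid f α β := by
  rw [hf.setIntegral_sub_mul h] at ht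
  exact sub_pos.1 (pos_of_mul_pos_left ht (hf.mass_pos h).le)

theorem centroid_lt {α β : EReal} (h : α < β) {t : ℝ}
    (ht : ∫ x in seg α β, (x - t) * f x < 0) : centroid f α β < t := by
  rw [hf.setIntegral_sub_mul h] at ht
  exact sub_neg.1 (neg_of_mul_neg_left ht (hf.mass_pos h).le)

theorem setIntegral_seg_pos {α β : EReal} (h : α < β) {t : ℝ} (ht : (t : EReal) ≤ α) :
    0 < ∫ x in seg α β, (x - t) * f x := by
  obtain ⟨y, hy, hyβ⟩ := EReal.lt_iff_exists_real_btwn.1 h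
  have hsplit := seg_union hy.le hyβ.le
  rw [hsplit, setIntegral_union (seg_disjoint _ _ _) (measurableSet_seg _ _)
    (hf.integrable_sub_mul t).integrableOn (hf.integrable_sub_mul t).integrableOn]
  refine add_pos_of_nonneg_of_pos ?_ ?_
  · refine setIntegral_nonneg (measurableSet_seg _ _) fun x hx => ?_
    have : t ≤ x := EReal.coe_le_coe_iff.1 (ht.trans hx.1)
    exact mul_nonneg (sub_nonneg.2 this) (hf.pos x).le
  · refine setIntegral_pos_of_pos (measurableSet_seg _ _) (volume_seg_pos hyβ)
      (hf.integrable_sub_mul t).integrableOn fun x hx => ?_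
    have : t < x := EReal.coe_lt_coe_iff.1 ((ht.trans_lt hy).trans_le hx.1)
    exact mul_pos (sub_pos.2 this) (hf.pos x)

theorem setIntegral_seg_neg {α β : EReal} (h : α < β) {t : ℝ} (ht : β ≤ (t : EReal)) :
    ∫ x in seg α β, (x - t) * f x < 0 := by
  have key : 0 < ∫ x in seg α β, -((x - t) * f x) := by
    refine setIntegral_pos_of_pos (measurableSet_seg _ _) (volume_seg_pos h)
      (hf.integrable_sub_mul t).neg.integrableOn fun x hx => ?_
    have : x < t := EReal.coe_lt_coe_iff.1 (hx.2.trans_le ht)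
    nlinarith [hf.pos x]
  rw [integral_neg] at key
  linarith

theorem left_lt_centroid {α : ℝ} {β : EReal} (h : (α : EReal) < β) : α < centroid f α β :=
  hf.lt_centroid h (hf.setIntegral_seg_pos h le_rfl)

theorem centroid_lt_right {α : EReal} {β : ℝ} (h : α < (β : EReal)) : centroid f α β < β :=
  hf.centroid_lt h (hf.setIntegral_seg_neg h le_rfl)

/-- The mass added lies to the right of `β`, hence of the old centroid, so its moment about the old
centroid is positive. -/
theorem centroid_lt_of_lt_right {α β β' : EReal} (h : α < β) (h' : β < β') :
    centroid f α β < centroid f α β' := by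
  refine hf.lt_centroid (h.trans h') ?_
  rw [seg_union h.le h'.le, setIntegral_union (seg_disjoint _ _ _) (measurableSet_seg _ _)
    (hf.integrable_sub_mul _).integrableOn (hf.integrable_sub_mul _).integrableOn,
    hf.setIntegral_sub_mul h, sub_self, zero_mul, zero_add]
  refine hf.setIntegral_seg_pos h' ?_
  have hb : β = (β.toReal : EReal) := (EReal.coe_toReal h'.ne_top h.ne_bot).symm
  rw [hb] at h ⊢
  exact EReal.coe_le_coe_iff.2 (hf.centroid_lt_right h).le

theorem centroid_lt_of_lt_left {α α' β : EReal} (h : α < α') (h' : α' < β) :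
    centroid f α β < centroid f α' β := by
  refine hf.centroid_lt (h.trans h') ?_
  rw [seg_union h.le h'.le, setIntegral_union (seg_disjoint _ _ _) (measurableSet_seg _ _)
    (hf.integrable_sub_mul _).integrableOn (hf.integrable_sub_mul _).integrableOn,
    hf.setIntegral_sub_mul h', sub_self, zero_mul, add_zero]
  refine hf.setIntegral_seg_neg h ?_
  have hb : α' = (α'.toReal : EReal) := (EReal.coe_toReal h'.ne_top h.ne_bot).symm
  rw [hb] at h' ⊢
  exact EReal.coe_le_coe_iff.2 (hf.left_lt_centroid h').le

theorem centroid_mono_right {α β β' : EReal} (h : α < β) (h' : β ≤ β') :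
    centroid f α β ≤ centroid f α β' := by
  rcases h'.eq_or_lt with rfl | h'
  · rfl
  · exact (hf.centroid_lt_of_lt_right h h').le

theorem centroid_mono_left {α α' β : EReal} (h : α ≤ α') (h' : α' < β) :
    centroid f α β ≤ centroid f α' β := by
  rcases h.eq_or_lt with rfl | h
  · rfl
  · exact (hf.centroid_lt_of_lt_left h h').le

/-- Adjacent segments have strictly increasing centroids. -/
theorem centroid_lt_centroid {α β γ : EReal} (h : α < β) (h' : β < γ) :
    centroid f α β < centroid f β γ :=
  (hf.centroid_lt_of_lt_right h h').trans (hf.centroid_lt_of_lt_left h h')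

end LogConcaveWeight

/-! ### Translates of segments and of their centroids -/

theorem add_coe_lt_add_coe_iff {α β : EReal} (h : ℝ) : α + h < β + h ↔ α < β := by
  refine ⟨fun H => ?_, fun H => EReal.add_lt_add_right_coe H h⟩
  by_contra hc
  rcases (not_lt.1 hc).eq_or_lt with rfl | hc
  · exact lt_irrefl _ H
  · exact lt_asymm H (EReal.add_lt_add_right_coe hc h)

theorem preimage_add_seg (α β : EReal) (h : ℝ) :
    (fun x : ℝ => x + h) ⁻¹' seg (α + h) (β + h) = seg α β := by
  ext x
  change (α + h ≤ ((x + h : ℝ) : EReal) ∧ ((x + h : ℝ) : EReal) < β + h) ↔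
    (α ≤ (x : EReal) ∧ (x : EReal) < β)
  rw [EReal.coe_add, add_coe_lt_add_coe_iff, ← not_lt, add_coe_lt_add_coe_iff, not_lt]

theorem setIntegral_seg_add (g : ℝ → ℝ) (α β : EReal) (h : ℝ) :
    ∫ x in seg (α + h) (β + h), g x = ∫ x in seg α β, g (x + h) := by
  rw [← preimage_add_seg α β h]
  exact ((measurePreserving_add_right volume h).setIntegral_preimage_emb
    (measurableEmbedding_addRight h) g _).symm

theorem exists_lt_of_integrable {f : ℝ → ℝ} (hf : Integrable f) {c : ℝ} (hc : 0 < c) (a : ℝ) :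
    ∃ x, a < x ∧ f x < c := by
  by_contra! H
  have h1 : IntegrableOn (fun _ : ℝ => c) (Set.Ioi a) := by
    refine Integrable.mono' hf.integrableOn aestronglyMeasurable_const ?_
    filter_upwards [ae_restrict_mem measurableSet_Ioi] with x hx
    rw [Real.norm_of_nonneg hc.le]
    exact H x hx
  rw [integrableOn_const_iff] at h1
  simp [hc.ne'] at h1

/-- A continuous function that vanishes almost everywhere on a segment vanishes on it. -/
theorem eq_zero_of_ae_seg {g : ℝ → ℝ} (hg : Continuous g) {α β : EReal}
    (h : ∀ᵐ x ∂volume.restrict (seg α β), g x = 0) : ∀ x ∈ seg α β, g x = 0 := by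
  intro x hx
  by_contra hne
  obtain ⟨ε, hε, hball⟩ := Metric.isOpen_iff.1 (isOpen_ne_fun hg continuous_const) x hne
  have hlt : (x : EReal) < min β ((x + ε : ℝ) : EReal) :=
    lt_min hx.2 (EReal.coe_lt_coe_iff.2 (by linarith))
  rw [ae_restrict_iff' (measurableSet_seg _ _)] at h
  have hzero : volume (seg x (min β ((x + ε : ℝ) : EReal))) = 0 := by
    refine measure_mono_null (fun y hy => ?_) h
    have h1 : x ≤ y := EReal.coe_le_coe_iff.1 hy.1
    have h2 : y < x + ε := EReal.coe_lt_coe_iff.1 (hy.2.trans_le (min_le_right _ _))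
    have h3 : g y ≠ 0 := hball (by rw [Metric.mem_ball, Real.dist_eq, abs_lt]; constructor <;> linarith)
    exact fun H => h3 (H ⟨hx.1.trans hy.1, hy.2.trans_le (min_le_left _ _)⟩)
  exact (volume_seg_pos hlt).ne' hzero

theorem coe_mem_closure_seg {α : EReal} {β : ℝ} (h : α < β) : β ∈ closure (seg α β) := by
  rw [Metric.mem_closure_iff]
  intro ε hε
  obtain ⟨y, hy, hyβ⟩ := EReal.lt_iff_exists_real_btwn.1
    (max_lt h (EReal.coe_lt_coe_iff.2 (sub_lt_self β hε)))
  have h1 : y < β := EReal.coe_lt_coe_iff.1 hyβ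
  have h2 : β - ε < y := EReal.coe_lt_coe_iff.1 ((le_max_right _ _).trans_lt hy)
  refine ⟨y, ⟨((le_max_left _ _).trans_lt hy).le, hyβ⟩, ?_⟩
  rw [Real.dist_eq, abs_lt]
  constructor <;> linarith

/-- On the set `s`, the translate of `f` by `h` is proportional to `f`. -/
def ConstRatioOn (f : ℝ → ℝ) (h : ℝ) (s : Set ℝ) : Prop :=
  ∃ C : ℝ, ∀ x ∈ s, f (x + h) = C * f x

namespace LogConcaveWeight

variable {f : ℝ → ℝ} (hf : LogConcaveWeight f)
include hf

/-- This says that `f (x + h) / f x` is nonincreasing in `x`. The points `x + h` and `y` lie between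
`x` and `y + h` and have the same sum, so the two concavity inequalities for `log f`, with weights
`t` and `1 - t` exchanged, add up to the claim. -/
theorem mul_le_mul_translate {x y h : ℝ} (hxy : x ≤ y) (hh : 0 ≤ h) :
    f x * f (y + h) ≤ f (x + h) * f y := by
  rcases hxy.eq_or_lt with rfl | hxy
  · rw [mul_comm]
  have hd : 0 < y + h - x := by linarith
  set t := h / (y + h - x) with ht
  have ht0 : 0 ≤ t := div_nonneg hh hd.le
  have ht1 : t ≤ 1 := (div_le_one hd).2 (by linarith)
  have htd : t * (y + h - x) = h := div_mul_cancel₀ _ hd.ne'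
  have h1 := hf.concave.2 (Set.mem_univ x) (Set.mem_univ (y + h)) (sub_nonneg.2 ht1) ht0 (by ring)
  have h2 := hf.concave.2 (Set.mem_univ x) (Set.mem_univ (y + h)) ht0 (sub_nonneg.2 ht1) (by ring)
  simp only [smul_eq_mul] at h1 h2
  rw [show (1 - t) * x + t * (y + h) = x + h by linear_combination htd] at h1
  rw [show t * x + (1 - t) * (y + h) = y by linear_combination -htd] at h2
  rw [← Real.log_le_log_iff (mul_pos (hf.pos _) (hf.pos _)) (mul_pos (hf.pos _) (hf.pos _)),
    Real.log_mul (hf.pos _).ne' (hf.pos _).ne', Real.log_mul (hf.pos _).ne' (hf.pos _).ne']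
  linarith

theorem sub_mul_translate_nonpos (x c : ℝ) {h : ℝ} (hh : 0 ≤ h) :
    (x - c) * (f (x + h) * f c - f (c + h) * f x) ≤ 0 := by
  rcases le_total x c with hx | hx
  · have := hf.mul_le_mul_translate hx hh
    exact mul_nonpos_of_nonpos_of_nonneg (by linarith) (by linarith)
  · have := hf.mul_le_mul_translate hx hh
    exact mul_nonpos_of_nonneg_of_nonpos (by linarith) (by linarith)

theorem integrable_sub_mul_translate (t h : ℝ) : Integrable (fun x => (x - t) * f (x + h)) := by
  refine ((hf.integrable_sub_mul (t + h)).comp_add_right h).congr (Filter.Eventually.of_forall ?_)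
  intro x
  change (x + h - (t + h)) * f (x + h) = (x - t) * f (x + h)
  ring

/-- The displacement of the centroid relative to `h` is the moment of the translated weight about `c
= centroid f α β`. Subtracting a multiple of the vanishing moment of `f` about `c` produces an
integrand of constant sign. -/
theorem translate_identity {α β : EReal} (hαβ : α < β) (h : ℝ) :
    f (centroid f α β) * ((centroid f (α + h) (β + h) - (centroid f α β + h)) *
      ∫ x in seg (α + h) (β + h), f x) =
    ∫ x in seg α β, (x - centroid f α β) * (f (x + h) * f (centroid f α β) -
      f (centroid f α β + h) * f x) := by
  set c := centroid f α β with hc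
  rw [← hf.setIntegral_sub_mul (EReal.add_lt_add_right_coe hαβ h), setIntegral_seg_add]
  have h0 : ∫ x in seg α β, (x - c) * f x = 0 := by
    rw [hf.setIntegral_sub_mul hαβ, hc, sub_self, zero_mul]
  have e : ∀ x, (x - c) * (f (x + h) * f c - f (c + h) * f x) =
      f c * ((x - c) * f (x + h)) - f (c + h) * ((x - c) * f x) := fun x => by ring
  simp only [e]
  rw [integral_sub ((hf.integrable_sub_mul_translate c h).const_mul _).integrableOn
    ((hf.integrable_sub_mul c).const_mul _).integrableOn, integral_const_mul, integral_const_mul,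
    h0, mul_zero, sub_zero]
  congr 1
  refine setIntegral_congr_fun (measurableSet_seg _ _) fun x _ => ?_
  ring

theorem centroid_add_le {α β : EReal} (hαβ : α < β) {h : ℝ} (hh : 0 ≤ h) :
    centroid f (α + h) (β + h) ≤ centroid f α β + h := by
  have key := hf.translate_identity hαβ h
  have h1 : ∫ x in seg α β, (x - centroid f α β) * (f (x + h) * f (centroid f α β) -
      f (centroid f α β + h) * f x) ≤ 0 :=
    setIntegral_nonpos (measurableSet_seg _ _) fun x _ => hf.sub_mul_translate_nonpos x _ hh
  rw [← key] at h1
  have h2 := nonpos_of_mul_nonpos_right h1 (hf.pos _)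
  have h3 := nonpos_of_mul_nonpos_left h2 (hf.mass_pos (EReal.add_lt_add_right_coe hαβ h))
  linarith

/-- In `translate_identity` an integrand of constant sign now has integral zero, so it vanishes
almost everywhere. Its second factor is continuous and zero at `c` anyway, hence zero on the whole
segment. -/
theorem constRatioOn_of_centroid_add_eq {α β : EReal} (hαβ : α < β) {h : ℝ} (hh : 0 ≤ h)
    (heq : centroid f (α + h) (β + h) = centroid f α β + h) : ConstRatioOn f h (seg α β) := by
  have key := hf.translate_identity hαβ h
  rw [heq, sub_self, zero_mul, mul_zero] at key
  set c := centroid f α β with hc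
  have hint : IntegrableOn (fun x => -((x - c) * (f (x + h) * f c - f (c + h) * f x)))
      (seg α β) := by
    have e : ∀ x, -((x - c) * (f (x + h) * f c - f (c + h) * f x)) =
      f (c + h) * ((x - c) * f x) - f c * ((x - c) * f (x + h)) := fun x => by ring
    simp only [e]
    exact (((hf.integrable_sub_mul c).const_mul _).sub
      ((hf.integrable_sub_mul_translate c h).const_mul _)).integrableOn
  have hz : ∫ x in seg α β, -((x - c) * (f (x + h) * f c - f (c + h) * f x)) = 0 := by
    rw [integral_neg, ← key, neg_zero]
  rw [setIntegral_eq_zero_iff_of_nonneg_ae (Filter.Eventually.of_forall fun x =>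
    neg_nonneg.2 (hf.sub_mul_translate_nonpos x c hh)) hint] at hz
  have hcont : Continuous fun x => f (x + h) * f c - f (c + h) * f x := by
    have := hf.continuous
    fun_prop
  have hall : ∀ x ∈ seg α β, f (x + h) * f c - f (c + h) * f x = 0 := by
    refine eq_zero_of_ae_seg hcont ?_
    filter_upwards [hz] with x hx
    rcases eq_or_ne x c with rfl | hne
    · ring
    · exact (mul_eq_zero.1 (neg_eq_zero.1 hx)).resolve_left (sub_ne_zero.2 hne)
  refine ⟨f (c + h) / f c, fun x hx => ?_⟩
  have := hall x hx
  have hpos := (hf.pos c).ne'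
  field_simp
  linarith

/-- The left relation extends by continuity to `β`, where the right one also holds; as `f β > 0`,
the two constants agree. -/
theorem constRatioOn_glue {α γ : EReal} {β : ℝ} {h : ℝ} (hαβ : α < β) (hβγ : (β : EReal) < γ)
    (h₁ : ConstRatioOn f h (seg α β)) (h₂ : ConstRatioOn f h (seg β γ)) :
    ConstRatioOn f h (seg α γ) := by
  obtain ⟨C, hC⟩ := h₁
  obtain ⟨C', hC'⟩ := h₂
  have hclosed : IsClosed {x | f (x + h) = C * f x} := by
    have := hf.continuous
    exact isClosed_eq (by fun_prop) (by fun_prop)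
  have hβ : f (β + h) = C * f β := closure_minimal (fun x hx => hC x hx) hclosed
    (coe_mem_closure_seg hαβ)
  have hβ' := hC' β ⟨le_rfl, hβγ⟩
  have hCC : C = C' := mul_right_cancel₀ (hf.pos β).ne' (hβ.symm.trans hβ')
  refine ⟨C, fun x hx => ?_⟩
  rw [seg_union hαβ.le hβγ.le] at hx
  rcases hx with hx | hx
  · exact hC x hx
  · rw [hCC]; exact hC' x hx

/-- Translation preserves the integral, so `C = 1` and `f` is periodic. Concavity of `log f` then
gives `f ≥ f 0` on every `[0, n * h]`, contrary to integrability. -/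
theorem not_constRatioOn_univ {h : ℝ} (hh : 0 < h) : ¬ ConstRatioOn f h (seg ⊥ ⊤) := by
  rintro ⟨C, hC⟩
  have hC : ∀ x, f (x + h) = C * f x := fun x => hC x ⟨bot_le, EReal.coe_lt_top x⟩
  have hpos : 0 < ∫ x, f x := by
    simpa using setIntegral_pos_of_pos MeasurableSet.univ (by simp) hf.integrable.integrableOn
      fun x _ => hf.pos x
  have h1 := integral_add_right_eq_self (μ := volume) f h
  simp only [hC] at h1
  rw [integral_const_mul] at h1
  have hC1 : C = 1 := by
    have : (C - 1) * ∫ x, f x = 0 := by linarith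
    linarith [(mul_eq_zero.1 this).resolve_right hpos.ne']
  have hper : ∀ n : ℕ, f (n * h) = f 0 := by
    intro n
    induction n with
    | zero => simp
    | succ n ih => rw [← ih, Nat.cast_succ, add_mul, one_mul, hC, hC1, one_mul]
  obtain ⟨x, hx0, hx⟩ := exists_lt_of_integrable hf.integrable (hf.pos 0) 0
  obtain ⟨n, hn⟩ := exists_nat_ge (x / h)
  rw [div_le_iff₀ hh] at hn
  have := hf.concave.min_le_of_mem_Icc (Set.mem_univ 0) (Set.mem_univ (n * h)) ⟨hx0.le, hn⟩
  simp only [hper, min_self] at this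
  rw [Real.log_le_log_iff (hf.pos _) (hf.pos _)] at this
  linarith

end LogConcaveWeight

/-! ### Adjoining one bin on the right -/

/-- The properties, as a function of the right edge, of the last action of a configuration of bins
that ends at this edge. -/
structure IsLastAction (f V : ℝ → ℝ) : Prop where
  lt_self : ∀ e, V e < e
  mono : Monotone V
  add_le : ∀ e h, 0 ≤ h → V (e + h) ≤ V e + h
  constRatioOn : ∀ e h, 0 < h → V (e + h) = V e + h → ConstRatioOn f h (seg ⊥ e)
  unbounded : ∀ K, ∃ e, K < e - V e

theorem continuous_of_monotone_of_add_le {V : ℝ → ℝ} (hm : Monotone V)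
    (h : ∀ e h, 0 ≤ h → V (e + h) ≤ V e + h) : Continuous V := by
  refine (LipschitzWith.of_le_add fun x y => ?_).continuous
  rcases le_total x y with hxy | hxy
  · exact (hm hxy).trans (le_add_of_nonneg_right dist_nonneg)
  · have := h y (x - y) (sub_nonneg.2 hxy)
    rwa [add_sub_cancel, ← abs_of_nonneg (sub_nonneg.2 hxy), ← Real.dist_eq] at this

namespace IsLastAction

variable {f V : ℝ → ℝ} (hV : IsLastAction f V)
include hV

theorem sub_mono {e e' : ℝ} (h : e ≤ e') : e - V e ≤ e' - V e' := by
  have := hV.add_le e (e' - e) (sub_nonneg.2 h)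
  rw [add_sub_cancel] at this
  linarith

theorem continuous : Continuous V := continuous_of_monotone_of_add_le hV.mono hV.add_le

end IsLastAction

namespace LogConcaveWeight

variable {f : ℝ → ℝ} (hf : LogConcaveWeight f)
include hf

theorem centroid_left_add_le {e h : ℝ} {E : EReal} (hh : 0 ≤ h) (hE : ((e + h : ℝ) : EReal) < E) :
    centroid f ((e + h : ℝ) : EReal) E ≤ centroid f e E + h := by
  have he : (e : EReal) < E := (EReal.coe_le_coe_iff.2 (by linarith)).trans_lt hE
  refine le_trans (hf.centroid_mono_right hE ?_) (hf.centroid_add_le he hh)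
  exact le_add_of_nonneg_right (EReal.coe_nonneg.2 hh)

theorem continuousOn_centroid_left (E : EReal) {a c : ℝ} (hc : (c : EReal) < E) :
    ContinuousOn (fun e : ℝ => centroid f e E) (Set.Icc a c) := by
  refine (LipschitzOnWith.of_le_add fun x hx y hy => ?_).continuousOn
  have hxE : (x : EReal) < E := (EReal.coe_le_coe_iff.2 hx.2).trans_lt hc
  have hyE : (y : EReal) < E := (EReal.coe_le_coe_iff.2 hy.2).trans_lt hc
  rcases le_total x y with hxy | hxy
  · exact (hf.centroid_mono_left (EReal.coe_le_coe_iff.2 hxy) hyE).trans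
      (le_add_of_nonneg_right dist_nonneg)
  · have e1 : y + (x - y) = x := by ring
    have := hf.centroid_left_add_le (e := y) (sub_nonneg.2 hxy) (by rwa [e1])
    rwa [e1, ← abs_of_nonneg (sub_nonneg.2 hxy), ← Real.dist_eq] at this

variable {V : ℝ → ℝ} {b : ℝ}

/-- The intermediate value theorem for `φ e = (e - V e) - (centroid f e E - e) - 2 * b`. The sign of
`b` matters only for finite `E`: there the second bracket tends to `0` as `e` approaches `E`, while
the first stays positive. -/
theorem exists_edge (hV : IsLastAction f V) (hb : b ≤ 0) {E : EReal} (hE : E ≠ ⊥) :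
    ∃ e : ℝ, (e : EReal) < E ∧ 2 * (e - b) = V e + centroid f e E := by
  set φ : ℝ → ℝ := fun e => 2 * (e - b) - (V e + centroid f e E) with hφ
  obtain ⟨e₀, -, he₀⟩ := EReal.lt_iff_exists_real_btwn.1 (bot_lt_iff_ne_bot.2 hE)
  have hpos : ∃ e₂ : ℝ, e₀ ≤ e₂ ∧ (e₂ : EReal) < E ∧ 0 ≤ φ e₂ := by
    induction E with
    | bot => exact absurd rfl hE
    | top =>
      obtain ⟨e₁, he₁⟩ := hV.unbounded (centroid f e₀ ⊤ - e₀ + 2 * b)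
      refine ⟨max e₀ e₁, le_max_left _ _, EReal.coe_lt_top _, ?_⟩
      have h1 := hV.sub_mono (le_max_right e₀ e₁)
      have h2 := hf.centroid_left_add_le (e := e₀) (h := max e₀ e₁ - e₀) (E := ⊤)
        (sub_nonneg.2 (le_max_left _ _)) (EReal.coe_lt_top _)
      rw [add_sub_cancel] at h2
      simp only [hφ]
      linarith
    | coe E =>
      have he₀' := EReal.coe_lt_coe_iff.1 he₀
      -- This choice gives `centroid f e₂ E - e₂ < E - e₂ ≤ e₀ - V e₀ ≤ e₂ - V e₂`.
      set e₂ := max e₀ (E - (e₀ - V e₀)) with he₂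
      have hlt : e₂ < E := max_lt he₀' (by linarith [hV.lt_self e₀])
      refine ⟨e₂, le_max_left _ _, EReal.coe_lt_coe_iff.2 hlt, ?_⟩
      have h1 := hV.sub_mono (le_max_left e₀ (E - (e₀ - V e₀)))
      have h2 := hf.centroid_lt_right (EReal.coe_lt_coe_iff.2 hlt)
      have h3 := le_max_right e₀ (E - (e₀ - V e₀))
      simp only [hφ]
      linarith
  obtain ⟨e₂, h02, he₂E, he₂⟩ := hpos
  have hneg : ∃ e₁ : ℝ, e₁ ≤ e₀ ∧ φ e₁ ≤ 0 := by
    refine ⟨min e₀ (2 * b - (e₀ - V e₀) + centroid f ⊥ E), min_le_left _ _, ?_⟩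
    set e₁ := min e₀ (2 * b - (e₀ - V e₀) + centroid f ⊥ E) with he₁
    have h1 := hV.sub_mono (min_le_left e₀ (2 * b - (e₀ - V e₀) + centroid f ⊥ E))
    have h2 : centroid f ⊥ E ≤ centroid f e₁ E := hf.centroid_mono_left bot_le
      ((EReal.coe_le_coe_iff.2 (min_le_left _ _)).trans_lt he₀)
    have h3 := min_le_right e₀ (2 * b - (e₀ - V e₀) + centroid f ⊥ E)
    simp only [hφ]
    linarith
  obtain ⟨e₁, h10, he₁⟩ := hneg
  have hcont : ContinuousOn φ (Set.Icc e₁ e₂) :=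
    ContinuousOn.sub (by fun_prop)
      (hV.continuous.continuousOn.add (hf.continuousOn_centroid_left E he₂E))
  obtain ⟨e, he, hz⟩ := intermediate_value_Icc (h10.trans h02) hcont ⟨he₁, he₂⟩
  exact ⟨e, (EReal.coe_le_coe_iff.2 he.2).trans_lt he₂E, by simp only [hφ] at hz; linarith⟩

/-- With `e' = e + h`, both edge equations force equality in the translation estimates for `V` and
for the last bin. For `E < ⊤` the latter is strict, because the right end stays fixed; for `E = ⊤`
the constant ratios on both sides of `e` glue to the whole line. -/
theorem le_of_edge (hV : IsLastAction f V) {E : EReal} {e e' : ℝ} (heE : (e : EReal) < E)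
    (he : 2 * (e - b) = V e + centroid f e E) (heE' : (e' : EReal) < E)
    (he' : 2 * (e' - b) = V e' + centroid f e' E) : e' ≤ e := by
  by_contra! hlt
  obtain ⟨h, hh, rfl⟩ : ∃ h, 0 < h ∧ e' = e + h := ⟨e' - e, sub_pos.2 hlt, by ring⟩
  have h1 := hV.add_le e h hh.le
  have h2 := hf.centroid_add_le heE hh.le
  have hle : E ≤ E + h := le_add_of_nonneg_right (EReal.coe_nonneg.2 hh.le)
  have h3 : centroid f ((e + h : ℝ) : EReal) E ≤ centroid f ((e + h : ℝ) : EReal) (E + h) :=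
    hf.centroid_mono_right heE' hle
  rw [← EReal.coe_add] at h2
  have hE : E = ⊤ := by
    by_contra hE
    have hlt : E < E + h := by
      have := EReal.add_lt_add_of_lt_of_le' (EReal.coe_pos.2 hh) (le_refl E)
        heE.ne_bot (by simp [hE])
      rwa [zero_add, add_comm] at this
    have := hf.centroid_lt_of_lt_right heE' hlt
    linarith
  subst hE
  refine hf.not_constRatioOn_univ hh (hf.constRatioOn_glue (EReal.bot_lt_coe e) heE
    (hV.constRatioOn e h hh (by linarith))
    (hf.constRatioOn_of_centroid_add_eq heE hh.le ?_))
  rw [← EReal.coe_add]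
  linarith

theorem edge_unique (hV : IsLastAction f V) {E : EReal} {e e' : ℝ} (heE : (e : EReal) < E)
    (he : 2 * (e - b) = V e + centroid f e E) (heE' : (e' : EReal) < E)
    (he' : 2 * (e' - b) = V e' + centroid f e' E) : e' = e :=
  le_antisymm (hf.le_of_edge hV heE he heE' he') (hf.le_of_edge hV heE' he' heE he)

theorem isLastAction_centroid_bot : IsLastAction f (fun e => centroid f ⊥ e) where
  lt_self e := hf.centroid_lt_right (EReal.bot_lt_coe e)
  mono e e' h := hf.centroid_mono_right (EReal.bot_lt_coe e) (EReal.coe_le_coe_iff.2 h)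
  add_le e h hh := by simpa using hf.centroid_add_le (EReal.bot_lt_coe e) hh
  constRatioOn e h hh heq :=
    hf.constRatioOn_of_centroid_add_eq (EReal.bot_lt_coe e) hh.le (by simpa using heq)
  unbounded K := by
    refine ⟨centroid f ⊥ ⊤ + K + 1, ?_⟩
    have := hf.centroid_mono_right (EReal.bot_lt_coe (centroid f ⊥ ⊤ + K + 1)) le_top
    linarith

/-- If `V` is the last action of a configuration, and `T` the right edge of this configuration when
one further bin, with the right edge `E`, is adjoined, then the centroid of this further bin is a
last action. -/
theorem isLastAction_step (hV : IsLastAction f V) {T : ℝ → ℝ} (hT : ∀ E, T E < E)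
    (hedge : ∀ E : ℝ, 2 * (T E - b) = V (T E) + centroid f (T E) E) :
    IsLastAction f (fun E => centroid f (T E) E) := by
  have hT' : ∀ E : ℝ, (T E : EReal) < (E : EReal) := fun E => EReal.coe_lt_coe_iff.2 (hT E)
  -- If `T E' < T E` with `E ≤ E'`, translating the last bin of `E'` by `T E - T E'` shows that
  -- `centroid - T` is strictly smaller at `E`, whereas `T - V T` is at least as large. The edge
  -- equations say that these two quantities differ by `2 * b` at both places.
  have hmono : Monotone T := by
    intro E E' hE
    by_contra! hlt
    have hEE : ((T E : ℝ) : EReal) < (E' : EReal) := (hT' E).trans_le (EReal.coe_le_coe_iff.2 hE)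
    have h1 := hV.sub_mono hlt.le
    have h3 := hf.centroid_add_le (hT' E') (sub_nonneg.2 hlt.le)
    rw [← EReal.coe_add, ← EReal.coe_add, add_sub_cancel] at h3
    have h5 := hf.centroid_lt_of_lt_right (hT' E) (EReal.coe_lt_coe_iff.2
      (hE.trans_lt (lt_add_of_pos_right E' (sub_pos.2 hlt))) :
        (E : EReal) < ((E' + (T E - T E') : ℝ) : EReal))
    have := hedge E
    have := hedge E'
    linarith
  -- The same comparison: if `T (E + h)` exceeded `T E + h`, the last bin at `E + h` would begin too
  -- far to the right for its edge equation.
  have hadd : ∀ E h, 0 ≤ h → T (E + h) ≤ T E + h := by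
    intro E h hh
    by_contra! hlt
    have hlt' : ((T E + h : ℝ) : EReal) < ((E + h : ℝ) : EReal) :=
      EReal.coe_lt_coe_iff.2 (by linarith [hT E])
    have h1 := hV.sub_mono hlt.le
    have h2 := hV.sub_mono (le_add_of_nonneg_right hh : T E ≤ T E + h)
    have h3 := hf.centroid_add_le (hT' E) hh
    rw [← EReal.coe_add, ← EReal.coe_add] at h3
    set d := T (E + h) - (T E + h) with hd
    have hd0 : 0 < d := sub_pos.2 hlt
    have h4 := hf.centroid_add_le hlt' hd0.le
    have h5 : centroid f (T (E + h)) ((E + h : ℝ) : EReal) <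
        centroid f (T (E + h)) ((E + h + d : ℝ) : EReal) :=
      hf.centroid_lt_of_lt_right (hT' _) (EReal.coe_lt_coe_iff.2 (lt_add_of_pos_right _ hd0))
    rw [← EReal.coe_add, ← EReal.coe_add, show T E + h + d = T (E + h) by rw [hd]; ring] at h4
    have := hedge E
    have := hedge (E + h)
    linarith
  refine ⟨fun E => hf.centroid_lt_right (hT' E), fun E E' hE => ?_, fun E h hh => ?_,
    fun E h hh heq => ?_, fun K => ?_⟩
  · exact (hf.centroid_mono_right (hT' E) (EReal.coe_le_coe_iff.2 hE)).trans
      (hf.centroid_mono_left (EReal.coe_le_coe_iff.2 (hmono hE)) (hT' E'))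
  · refine (hf.centroid_mono_left (EReal.coe_le_coe_iff.2 (hadd E h hh))
      (EReal.coe_lt_coe_iff.2 (by linarith [hT E]))).trans ?_
    simpa using hf.centroid_add_le (hT' E) hh
  · have hlt' : ((T E + h : ℝ) : EReal) < ((E + h : ℝ) : EReal) :=
      EReal.coe_lt_coe_iff.2 (by linarith [hT E])
    have h3 := hf.centroid_add_le (hT' E) hh.le
    rw [← EReal.coe_add, ← EReal.coe_add] at h3
    -- Equality of the last actions leaves no slack: a smaller left edge would lower the centroid
    -- strictly. The edge equations then pass the equality on to `V`.
    have hTeq : T (E + h) = T E + h := by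
      refine (hadd E h hh.le).antisymm (not_lt.1 fun hlt => ?_)
      have := hf.centroid_lt_of_lt_left (EReal.coe_lt_coe_iff.2 hlt) hlt'
      linarith
    refine hf.constRatioOn_glue (EReal.bot_lt_coe _) (hT' E)
      (hV.constRatioOn (T E) h hh ?_)
      (hf.constRatioOn_of_centroid_add_eq (hT' E) hh.le ?_)
    · have h1 := hedge E
      have h2 := hedge (E + h)
      rw [heq, hTeq] at h2
      linarith
    · rw [← EReal.coe_add, ← EReal.coe_add, ← hTeq]
      exact heq
  -- If `E - centroid f (T E) E ≤ K` for all `E`, the bound `centroid f (T E) ⊤ ≤ R + T E` (valid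
  -- once `T E ≥ 0`) makes `T E` exceed `e₁` for large `E`. Then `T E - V (T E) > R + 2 * b`, but
  -- the edge equation bounds it by `R + 2 * b`.
  · by_contra! H
    obtain ⟨e₁, he₁⟩ := hV.unbounded (centroid f (0 : ℝ) ⊤ + 2 * b)
    set R := centroid f (0 : ℝ) ⊤ with hR
    obtain ⟨E, hE⟩ : ∃ E : ℝ, R + K + 1 ≤ E ∧ e₁ + K + R ≤ E :=
      ⟨max _ _, le_max_left _ _, le_max_right _ _⟩
    have h1 := H E
    have htop := hf.centroid_mono_right (hT' E) le_top
    have h0 : 0 ≤ T E := by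
      by_contra! hneg
      have := hf.centroid_mono_left (EReal.coe_le_coe_iff.2 hneg.le) (EReal.coe_lt_top (0 : ℝ))
      linarith
    have h2 := hf.centroid_left_add_le (e := 0) h0 (EReal.coe_lt_top (0 + T E))
    rw [zero_add] at h2
    have h3 := hV.sub_mono (show e₁ ≤ T E by linarith)
    have h4 := hedge E
    linarith

end LogConcaveWeight

/-! ### Existence and uniqueness of chains of bins -/

/-- Edges `m 0 = -∞ < m 1 < … < m N = E` such that, when the bins are answered by their centroids,
the encoder with bias `b` is indifferent at the inner edges. -/
structure IsBinChain (f : ℝ → ℝ) (b : ℝ) (N : ℕ) (E : EReal) (m : ℕ → EReal) : Prop where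
  first : m 0 = ⊥
  last : m N = E
  lt_succ : ∀ k < N, m k < m (k + 1)
  indifferent : ∀ k, k + 1 < N → 2 * ((m (k + 1)).toReal - b) =
    centroid f (m k) (m (k + 1)) + centroid f (m (k + 1)) (m (k + 2))

namespace IsBinChain

variable {f : ℝ → ℝ} {b : ℝ} {N : ℕ} {E : EReal} {m : ℕ → EReal}

theorem coe_toReal (h : IsBinChain f b N E m) {k : ℕ} (hk : k + 1 < N) :
    ((m (k + 1)).toReal : EReal) = m (k + 1) :=
  EReal.coe_toReal (h.lt_succ (k + 1) hk).ne_top (h.lt_succ k (by omega)).ne_bot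

theorem init (h : IsBinChain f b (N + 1) E m) : IsBinChain f b N (m N) m :=
  ⟨h.first, rfl, fun k hk => h.lt_succ k (by omega), fun k hk => h.indifferent k (by omega)⟩

theorem snoc (h : IsBinChain f b (N + 1) (m (N + 1)) m) (hE : m (N + 1) < E)
    (hi : 2 * ((m (N + 1)).toReal - b) =
      centroid f (m N) (m (N + 1)) + centroid f (m (N + 1)) E) :
    IsBinChain f b (N + 2) E (fun k => if k ≤ N + 1 then m k else E) where
  first := by simp [h.first]
  last := by simp
  lt_succ k hk := by
    rcases (Nat.lt_succ_iff.1 hk).eq_or_lt with rfl | hk'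
    · simpa using hE
    · simpa [hk'.le, Nat.succ_le_iff.2 hk'] using h.lt_succ k hk'
  indifferent k hk := by
    rcases (Nat.lt_succ_iff.1 hk).eq_or_lt with hk' | hk'
    · obtain rfl : k = N := by omega
      simpa using hi
    · have h1 : k ≤ N + 1 := by omega
      have h2 : k + 1 ≤ N + 1 := by omega
      have h3 : k + 2 ≤ N + 1 := by omega
      simp only [h1, h2, h3, if_true]
      exact h.indifferent k hk'

end IsBinChain

theorem setIntegral_seg_neg_neg (g : ℝ → ℝ) (α β : EReal) :
    ∫ x in seg (-β) (-α), g x = ∫ x in seg α β, g (-x) := by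
  have h1 := (Measure.measurePreserving_neg (volume : Measure ℝ)).setIntegral_preimage_emb
    (MeasurableEquiv.neg ℝ).measurableEmbedding g (seg (-β) (-α))
  rw [← h1]
  -- Reflection exchanges the closed and the open end, so the two sets agree only off the endpoints.
  refine setIntegral_congr_set ?_
  have hfin : ({α.toReal, β.toReal} : Set ℝ).Countable := (Set.toFinite _).countable
  filter_upwards [hfin.ae_notMem volume] with x hx
  refine propext ?_
  change (-β ≤ ((-x : ℝ) : EReal) ∧ ((-x : ℝ) : EReal) < -α) ↔ (α ≤ (x : EReal) ∧ (x : EReal) < β)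
  have hα : (x : EReal) ≠ α := fun h => hx (Or.inl (by rw [← h, EReal.toReal_coe]))
  have hβ : (x : EReal) ≠ β := fun h => hx (Or.inr (by
    rw [Set.mem_singleton_iff, ← h, EReal.toReal_coe]))
  rw [EReal.coe_neg, EReal.neg_le_neg_iff, EReal.neg_lt_neg_iff]
  exact ⟨fun h => ⟨h.2.le, lt_of_le_of_ne h.1 hβ⟩, fun h => ⟨h.2.le, lt_of_le_of_ne h.1 hα.symm⟩⟩

theorem centroid_comp_neg (f : ℝ → ℝ) (α β : EReal) :
    centroid (fun x => f (-x)) (-β) (-α) = -centroid f α β := by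
  rw [centroid, centroid, setIntegral_seg_neg_neg, setIntegral_seg_neg_neg, ← neg_div]
  simp only [neg_neg, neg_mul, integral_neg]

theorem IsBinChain.reflect {f : ℝ → ℝ} {b : ℝ} {N : ℕ} {m : ℕ → EReal}
    (h : IsBinChain f b N ⊤ m) :
    IsBinChain (fun x => f (-x)) (-b) N ⊤ (fun k => -m (N - k)) where
  first := by simp [h.last]
  last := by simp [h.first]
  lt_succ k hk := by
    have := h.lt_succ (N - (k + 1)) (by omega)
    rw [show N - (k + 1) + 1 = N - k by omega] at this
    exact EReal.neg_lt_neg_iff.2 this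
  indifferent k hk := by
    have := h.indifferent (N - (k + 2)) (by omega)
    rw [show N - (k + 2) + 1 = N - (k + 1) by omega,
      show N - (k + 2) + 2 = N - k by omega] at this
    simp only [centroid_comp_neg, EReal.toReal_neg_eq]
    linarith

namespace LogConcaveWeight

variable {f : ℝ → ℝ} (hf : LogConcaveWeight f)
include hf

theorem comp_neg : LogConcaveWeight (fun x => f (-x)) where
  continuous := hf.continuous.comp continuous_neg
  pos x := hf.pos _
  concave := by
    have := hf.concave.comp_linearMap (-LinearMap.id : ℝ →ₗ[ℝ] ℝ)
    exact this
  integrable := hf.integrable.comp_neg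
  integrable_mul := by simpa using hf.integrable_mul.comp_neg.neg
  integrable_sq_mul := by simpa using hf.integrable_sq_mul.comp_neg

/-- The induction needs all right edges `E`, finite or not, since truncating a chain that ends at
`⊤` leaves one with a finite end. `V` is the last action as a function of finite ends. -/
theorem binChain_aux {b : ℝ} (hb : b ≤ 0) (n : ℕ) : ∃ V, IsLastAction f V ∧
    (∀ (e : ℝ) (m : ℕ → EReal), IsBinChain f b (n + 1) e m → centroid f (m n) e = V e) ∧
    (∀ E, E ≠ ⊥ → ∃ m, IsBinChain f b (n + 1) E m) ∧
    (∀ E m m', IsBinChain f b (n + 1) E m → IsBinChain f b (n + 1) E m' →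
      ∀ k ≤ n + 1, m k = m' k) := by
  induction n with
  | zero =>
    refine ⟨_, hf.isLastAction_centroid_bot, fun e m hm => by rw [hm.first], fun E hE => ?_,
      fun E m m' hm hm' k hk => ?_⟩
    · refine ⟨fun k => if k = 0 then ⊥ else E, by simp, by simp, fun k hk => ?_, fun k hk => ?_⟩
      · obtain rfl : k = 0 := by omega
        simpa using bot_lt_iff_ne_bot.2 hE
      · omega
    · have : k = 0 ∨ k = 0 + 1 := by omega
      rcases this with rfl | rfl
      · rw [hm.first, hm'.first]
      · rw [hm.last, hm'.last]
  | succ n ih =>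
    obtain ⟨V, hV, hlast, hex, huniq⟩ := ih
    choose! T hT hedge using fun (E : EReal) (hE : E ≠ ⊥) => hf.exists_edge (b := b) hV hb hE
    -- The truncated chain has last action `V`, so the last inner edge solves the edge equation,
    -- whose solution is unique.
    have hinner : ∀ E m, IsBinChain f b (n + 1 + 1) E m → m (n + 1) = (T E : EReal) := by
      intro E m hm
      have hlt : m (n + 1) < E := hm.last ▸ hm.lt_succ (n + 1) (by omega)
      have hi := hm.indifferent n (by omega)
      have hc := hm.coe_toReal (k := n) (by omega)
      have hm' := hm.init
      rw [hm.last] at hi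
      rw [← hc] at hlt hm' hi ⊢
      rw [hlast _ _ hm', EReal.toReal_coe] at hi
      have hE : E ≠ ⊥ := hlt.ne_bot
      rw [hf.edge_unique hV (hT E hE) (hedge E hE) hlt hi]
    refine ⟨fun E => centroid f (T E) E, hf.isLastAction_step hV (T := fun E : ℝ => T E)
      (fun E => EReal.coe_lt_coe_iff.1 (hT E (EReal.coe_ne_bot E)))
      (fun E => hedge E (EReal.coe_ne_bot E)), fun e m hm => by rw [hinner _ _ hm],
      fun E hE => ?_, fun E m m' hm hm' k hk => ?_⟩
    · obtain ⟨m, hm⟩ := hex (T E) (EReal.coe_ne_bot _)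
      have hl := hm.last
      refine ⟨_, IsBinChain.snoc (m := m) (N := n) (hl.symm ▸ hm) (hl.symm ▸ hT E hE) ?_⟩
      rw [hl, EReal.toReal_coe, hlast _ _ hm]
      exact hedge E hE
    · rcases hk.eq_or_lt with rfl | hk
      · rw [hm.last, hm'.last]
      · have h1 := hm.init
        have h2 := hm'.init
        rw [hinner _ _ hm] at h1
        rw [hinner _ _ hm'] at h2
        exact huniq _ _ _ h1 h2 k (by omega)

theorem exists_binChain (b : ℝ) {N : ℕ} (hN : 1 ≤ N) : ∃ m, IsBinChain f b N ⊤ m := by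
  obtain ⟨n, rfl⟩ : ∃ n, N = n + 1 := ⟨N - 1, by omega⟩
  rcases le_total b 0 with hb | hb
  · obtain ⟨V, -, -, h, -⟩ := hf.binChain_aux hb n
    exact h ⊤ (by simp)
  · obtain ⟨V, -, -, h, -⟩ := hf.comp_neg.binChain_aux (neg_nonpos.2 hb) n
    obtain ⟨m, hm⟩ := h ⊤ (by simp)
    have := hm.reflect
    simp only [neg_neg] at this
    exact ⟨_, this⟩

theorem binChain_unique {b : ℝ} {N : ℕ} (hN : 1 ≤ N) {m m' : ℕ → EReal}
    (hm : IsBinChain f b N ⊤ m) (hm' : IsBinChain f b N ⊤ m') : ∀ k ≤ N, m k = m' k := by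
  obtain ⟨n, rfl⟩ : ∃ n, N = n + 1 := ⟨N - 1, by omega⟩
  intro k hk
  rcases le_total b 0 with hb | hb
  · obtain ⟨V, -, -, -, h⟩ := hf.binChain_aux hb n
    exact h ⊤ _ _ hm hm' k hk
  · obtain ⟨V, -, -, -, h⟩ := hf.comp_neg.binChain_aux (neg_nonpos.2 hb) n
    have := h ⊤ _ _ hm.reflect hm'.reflect (n + 1 - k) (by omega)
    simpa [Nat.sub_sub_self hk] using this

end LogConcaveWeight

/-! ### Finite second moment of a log-concave density -/

theorem integrableOn_Ioi_sq_mul {f : ℝ → ℝ} (hc : Continuous f) (hpos : ∀ x, 0 < f x)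
    (hconc : ConcaveOn ℝ Set.univ (fun x => Real.log (f x))) (hint : Integrable f) :
    IntegrableOn (fun x => x ^ 2 * f x) (Set.Ioi 0) := by
  obtain ⟨x₁, hx₁, hfx₁⟩ := exists_lt_of_integrable hint (hpos 0) 0
  -- Beyond `x₁`, the concave function `log f` lies below its chord through `0` and `x₁`, of slope
  -- `-s < 0`, so `f` decays exponentially. Half of this rate absorbs `x ^ 2`.
  set s := (Real.log (f 0) - Real.log (f x₁)) / x₁ with hs
  have hlog : Real.log (f x₁) < Real.log (f 0) := Real.log_lt_log (hpos _) hfx₁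
  have hs0 : 0 < s := div_pos (sub_pos.2 hlog) hx₁
  have hsx : s * x₁ = Real.log (f 0) - Real.log (f x₁) := div_mul_cancel₀ _ hx₁.ne'
  have hbound : ∀ x, x₁ ≤ x → f x ≤ f 0 * Real.exp (-s * x) := by
    intro x hx
    have hx0 : 0 < x := hx₁.trans_le hx
    rw [← Real.log_le_log_iff (hpos _) (mul_pos (hpos _) (Real.exp_pos _)),
      Real.log_mul (hpos _).ne' (Real.exp_pos _).ne', Real.log_exp]
    have h1 := hconc.2 (Set.mem_univ 0) (Set.mem_univ x)
      (sub_nonneg.2 ((div_le_one hx0).2 hx)) (div_nonneg hx₁.le hx0.le) (by ring)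
    simp only [smul_eq_mul, mul_zero, zero_add, div_mul_cancel₀ _ hx0.ne'] at h1
    have h2 : x₁ / x * (Real.log (f x) - Real.log (f 0)) ≤ -(s * x₁) := by linarith
    have h3 := mul_le_mul_of_nonneg_left h2 (div_nonneg hx0.le hx₁.le)
    rw [← mul_assoc, div_mul_div_cancel₀ hx₁.ne', div_self hx0.ne', one_mul] at h3
    have h4 : x / x₁ * -(s * x₁) = -s * x := by field_simp
    linarith
  refine integrable_of_isBigO_exp_neg (half_pos hs0)
    (((continuous_pow 2).mul hc).continuousOn) ?_
  have hO : (fun x : ℝ => x ^ 2) =O[Filter.atTop] fun x => Real.exp (s / 2 * x) :=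
    (isLittleO_pow_exp_pos_mul_atTop 2 (half_pos hs0)).isBigO
  have hO' : f =O[Filter.atTop] fun x => Real.exp (-s * x) := by
    refine Asymptotics.IsBigO.of_bound (f 0) ?_
    filter_upwards [Filter.eventually_ge_atTop x₁] with x hx
    rw [Real.norm_of_nonneg (hpos x).le, Real.norm_of_nonneg (Real.exp_pos _).le]
    exact hbound x hx
  refine (hO.mul hO').congr_right fun x => ?_
  rw [← Real.exp_add]
  ring_nf

theorem logConcaveWeight {f : ℝ → ℝ} (hf : IsProbabilityDensity f) (hlog : IsLogConcaveDensity f)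
    (hsupp : HasTwoSidedUnboundedSupport f) (hmean : HasFiniteMean f) : LogConcaveWeight f := by
  have hpos : ∀ x, 0 < f x := fun x => (hf.nonneg x).lt_of_ne' (by
    have : x ∈ Function.support f := by rw [hsupp]; trivial
    exact this)
  have hconc : ConcaveOn ℝ Set.univ (fun x => Real.log (f x)) := by
    have := hlog
    rwa [IsLogConcaveDensity, hsupp] at this
  have hcont : Continuous f := by
    have h1 := (hconc.continuousOn isOpen_univ).rexp
    simp only [Real.exp_log (hpos _)] at h1
    exact continuousOn_univ.1 h1
  have hint : Integrable f := by
    refine ⟨hf.measurable.aestronglyMeasurable, ?_⟩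
    rw [hasFiniteIntegral_iff_ofReal (Filter.Eventually.of_forall hf.nonneg),
      hf.lintegral_eq_one]
    exact ENNReal.one_lt_top
  refine ⟨hcont, hpos, hconc, hint, hmean, ?_⟩
  have h1 := integrableOn_Ioi_sq_mul hcont hpos hconc hint
  have h2 := integrableOn_Ioi_sq_mul (f := fun x => f (-x)) (hcont.comp continuous_neg)
    (fun x => hpos _) (hconc.comp_linearMap (-LinearMap.id : ℝ →ₗ[ℝ] ℝ)) hint.comp_neg
  have h3 : IntegrableOn (fun x => x ^ 2 * f x) (Set.Iio 0) := by
    rw [← (Measure.measurePreserving_neg (volume : Measure ℝ)).integrableOn_comp_preimage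
      (MeasurableEquiv.neg ℝ).measurableEmbedding]
    refine (h2.congr_fun (fun x _ => ?_) measurableSet_Ioi).congr_set_ae ?_
    · exact (congrArg (· * f (-x)) (neg_sq x)).symm
    · exact Filter.EventuallyEq.of_eq (by ext x; simp)
  have h4 : IntegrableOn (fun x => x ^ 2 * f x) (Set.Iic 0) := by
    rwa [integrableOn_Iic_iff_integrableOn_Iio]
  have h4 := h4.union h1
  rwa [Set.Iic_union_Ioi, integrableOn_univ] at h4

theorem lintegral_ofReal_ne_top {P : Measure ℝ} {g : ℝ → ℝ} (hg : Integrable g P) :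
    ∫⁻ x, ENNReal.ofReal (g x) ∂P ≠ ⊤ :=
  (lt_of_le_of_lt (lintegral_mono fun x => Real.ofReal_le_enorm (g x)) hg.2).ne

/-! ### Consequences of the Nash conditions -/

section Nash

variable {P : Measure ℝ} [IsProbabilityMeasure P] {b : ℝ} {γe γd : ℝ → ℝ}

theorem integrable_sub_sq (hsq : MemLp (fun x : ℝ => x) 2 P) (t : ℝ) :
    Integrable (fun x => (x - t) ^ 2) P :=
  (hsq.sub (memLp_const t)).integrable_sq

/-- At an equilibrium, the encoder cannot gain by sending any other message. -/
theorem IsNashEquilibrium.encoder_ae_le (h : IsNashEquilibrium P b γe γd)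
    (hsq : MemLp (fun x : ℝ => x) 2 P) (y : ℝ) :
    ∀ᵐ x ∂P, (x - γd (γe x) - b) ^ 2 ≤ (x - γd y - b) ^ 2 := by
  have hme := h.measurable_encoder
  have hmd := h.measurable_decoder
  set F : ℝ → ℝ := fun x => (x - γd (γe x) - b) ^ 2 with hF
  set G : ℝ → ℝ := fun x => (x - γd y - b) ^ 2 with hG
  have hFm : Measurable F := by
    have := hmd.comp hme
    exact ((measurable_id.sub this).sub_const b).pow_const 2
  have hGm : Measurable G := ((measurable_id.sub_const (γd y)).sub_const b).pow_const 2
  -- The deviation sends `y` exactly where this is strictly better. Its cost integrand is `min F G ≤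
  -- F`; optimality and finite cost force equality almost everywhere.
  set γ : ℝ → ℝ := fun x => if G x < F x then y else γe x with hγ
  have hγm : Measurable γ := Measurable.ite (measurableSet_lt hGm hFm) measurable_const hme
  have hcost : encoderCost P b γ γd = ∫⁻ x, ENNReal.ofReal (min (F x) (G x)) ∂P := by
    refine lintegral_congr fun x => ?_
    by_cases hx : G x < F x
    · rw [min_eq_right hx.le, show γ x = y from if_pos hx]
    · rw [min_eq_left (not_lt.1 hx), show γ x = γe x from if_neg hx]
  have hopt := h.encoder_optimal γ hγm
  have hfin : encoderCost P b γe γd ≠ ⊤ := by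
    refine ((h.encoder_optimal (fun _ => 0) measurable_const).trans_lt
      (lt_top_iff_ne_top.2 ?_)).ne
    simp only [encoderCost, sub_sub]
    exact lintegral_ofReal_ne_top (integrable_sub_sq hsq _)
  have hle : (fun x => ENNReal.ofReal (min (F x) (G x))) ≤ᵐ[P] fun x => ENNReal.ofReal (F x) :=
    Filter.Eventually.of_forall fun x => ENNReal.ofReal_le_ofReal (min_le_left _ _)
  have heq := ae_eq_of_ae_le_of_lintegral_le hle
    ((lintegral_mono_ae hle).trans_lt (lt_top_iff_ne_top.2 hfin)).ne
    hFm.ennreal_ofReal.aemeasurable (hcost ▸ hopt)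
  filter_upwards [heq] with x hx
  rw [ENNReal.ofReal_eq_ofReal_iff (le_min (sq_nonneg _) (sq_nonneg _)) (sq_nonneg _)] at hx
  exact min_eq_left_iff.1 hx

open Classical in
/-- At an equilibrium, the decoder is unbiased on every measurable set of messages. -/
theorem IsNashEquilibrium.decoder_setIntegral_eq_zero (h : IsNashEquilibrium P b γe γd)
    (hsq : MemLp (fun x : ℝ => x) 2 P) {Y : Set ℝ} (hY : MeasurableSet Y) :
    ∫ x in γe ⁻¹' Y, (x - γd (γe x)) ∂P = 0 := by
  have hme := h.measurable_encoder
  have hmd := h.measurable_decoder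
  have hDm : Measurable fun x => x - γd (γe x) := measurable_id.sub (hmd.comp hme)
  have hS : MeasurableSet (γe ⁻¹' Y) := hme hY
  have hfin : decoderCost P γe γd ≠ ⊤ := by
    refine ((h.decoder_optimal (fun _ => 0) measurable_const).trans_lt
      (lt_top_iff_ne_top.2 ?_)).ne
    exact lintegral_ofReal_ne_top (integrable_sub_sq hsq _)
  have hDsq : Integrable (fun x => (x - γd (γe x)) ^ 2) P := by
    refine ⟨(hDm.pow_const 2).aestronglyMeasurable, ?_⟩
    rw [hasFiniteIntegral_iff_ofReal (Filter.Eventually.of_forall fun x => sq_nonneg _)]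
    exact lt_top_iff_ne_top.2 hfin
  have hD : Integrable (fun x => x - γd (γe x)) P :=
    ((memLp_two_iff_integrable_sq hDm.aestronglyMeasurable).2 hDsq).integrable one_le_two
  set I := ∫ x in γe ⁻¹' Y, (x - γd (γe x)) ∂P with hI
  -- Shifting the answers to `Y` by `I` changes the cost by `(P (γe ⁻¹' Y) - 2) * I ^ 2 ≤ -I ^ 2`,
  -- so optimality forces `I = 0`.
  have hmeas : Measurable fun y => if y ∈ Y then γd y + I else γd y :=
    Measurable.ite hY (hmd.add_const I) hmd
  have hlin : Integrable (fun x => -2 * I * (x - γd (γe x)) + I ^ 2) P :=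
    (hD.const_mul _).add (integrable_const _)
  have hpt : ∀ x, (x - if γe x ∈ Y then γd (γe x) + I else γd (γe x)) ^ 2 =
      (x - γd (γe x)) ^ 2 +
        (γe ⁻¹' Y).indicator (fun x => -2 * I * (x - γd (γe x)) + I ^ 2) x := by
    intro x
    by_cases hx : γe x ∈ Y
    · rw [Set.indicator_of_mem (show x ∈ γe ⁻¹' Y from hx), if_pos hx]
      ring
    · rw [Set.indicator_of_notMem (show x ∉ γe ⁻¹' Y from hx), if_neg hx, add_zero]
  have hint : Integrable (fun x => (x - γd (γe x)) ^ 2 +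
      (γe ⁻¹' Y).indicator (fun x => -2 * I * (x - γd (γe x)) + I ^ 2) x) P :=
    hDsq.add (hlin.indicator hS)
  have hopt := h.decoder_optimal _ hmeas
  simp only [decoderCost, hpt] at hopt
  rw [← ofReal_integral_eq_lintegral_ofReal hDsq
      (Filter.Eventually.of_forall fun x => sq_nonneg _),
    ← ofReal_integral_eq_lintegral_ofReal hint
      (Filter.Eventually.of_forall fun x => (sq_nonneg _).trans_eq (hpt x)),
    ENNReal.ofReal_le_ofReal_iff (integral_nonneg fun x => (sq_nonneg _).trans_eq (hpt x)),
    integral_add hDsq (hlin.indicator hS), integral_indicator hS,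
    integral_add (hD.const_mul _).integrableOn (integrable_const _).integrableOn,
    integral_const_mul, setIntegral_const, ← hI, smul_eq_mul] at hopt
  have hp : P.real (γe ⁻¹' Y) ≤ 1 := measureReal_le_one
  have : I ^ 2 ≤ 0 := by nlinarith [mul_le_mul_of_nonneg_right hp (sq_nonneg I)]
  exact pow_eq_zero_iff two_ne_zero |>.1 (this.antisymm (sq_nonneg I))

/-- On a set with mean `c`, the action `c` is optimal. -/
theorem setLIntegral_sub_sq_le (hsq : MemLp (fun x : ℝ => x) 2 P) {S : Set ℝ} {c : ℝ}
    (hc : ∫ x in S, (x - c) ∂P = 0) (t : ℝ) :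
    ∫⁻ x in S, ENNReal.ofReal ((x - c) ^ 2) ∂P ≤ ∫⁻ x in S, ENNReal.ofReal ((x - t) ^ 2) ∂P := by
  rw [← ofReal_integral_eq_lintegral_ofReal (integrable_sub_sq hsq c).integrableOn
      (Filter.Eventually.of_forall fun x => sq_nonneg _),
    ← ofReal_integral_eq_lintegral_ofReal (integrable_sub_sq hsq t).integrableOn
      (Filter.Eventually.of_forall fun x => sq_nonneg _)]
  refine ENNReal.ofReal_le_ofReal ?_
  have hlin : Integrable (fun x => x - c) P :=
    (hsq.integrable one_le_two).sub (integrable_const c)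
  have e : ∀ x : ℝ, (x - t) ^ 2 = (x - c) ^ 2 + (2 * (c - t) * (x - c) + (c - t) ^ 2) :=
    fun x => by ring
  have hlin' : Integrable (fun x => 2 * (c - t) * (x - c) + (c - t) ^ 2) P :=
    (hlin.const_mul _).add (integrable_const _)
  rw [integral_congr_ae (Filter.Eventually.of_forall e),
    integral_add (integrable_sub_sq hsq c).integrableOn hlin'.integrableOn,
    integral_add (hlin.const_mul _).integrableOn (integrable_const _).integrableOn,
    integral_const_mul, hc, mul_zero, zero_add, setIntegral_const, smul_eq_mul]
  exact le_add_of_nonneg_right (mul_nonneg measureReal_nonneg (sq_nonneg _))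

end Nash

/-! ### The law of the source and the edges of the bins -/

section SourceLaw

variable {f : ℝ → ℝ}

theorem IsProbabilityDensity.isProbabilityMeasure (hf : IsProbabilityDensity f) :
    IsProbabilityMeasure (sourceLaw f) :=
  ⟨by rw [sourceLaw, withDensity_apply _ MeasurableSet.univ, Measure.restrict_univ,
    hf.lintegral_eq_one]⟩

namespace LogConcaveWeight

variable (hf : LogConcaveWeight f)
include hf

theorem measurable_ofReal : Measurable fun x => ENNReal.ofReal (f x) :=
  hf.continuous.measurable.ennreal_ofReal

theorem volume_absolutelyContinuous : volume ≪ sourceLaw f :=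
  withDensity_absolutelyContinuous' hf.measurable_ofReal.aemeasurable
    (Filter.Eventually.of_forall fun x => (ENNReal.ofReal_pos.2 (hf.pos x)).ne')

theorem setIntegral_sourceLaw (g : ℝ → ℝ) {S : Set ℝ} (hS : MeasurableSet S) :
    ∫ x in S, g x ∂sourceLaw f = ∫ x in S, g x * f x := by
  rw [sourceLaw, setIntegral_withDensity_eq_setIntegral_toReal_smul hf.measurable_ofReal
    (Filter.Eventually.of_forall fun x => ENNReal.ofReal_lt_top) _ hS]
  simp only [ENNReal.toReal_ofReal (hf.pos _).le, smul_eq_mul, mul_comm]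

theorem memLp_two_sourceLaw : MemLp (fun x : ℝ => x) 2 (sourceLaw f) := by
  rw [memLp_two_iff_integrable_sq measurable_id'.aestronglyMeasurable, sourceLaw,
    integrable_withDensity_iff hf.measurable_ofReal
      (Filter.Eventually.of_forall fun x => ENNReal.ofReal_lt_top)]
  simpa only [ENNReal.toReal_ofReal (hf.pos _).le] using hf.integrable_sq_mul

theorem setIntegral_sub_eq_zero_iff {α β : EReal} (h : α < β) (t : ℝ) :
    ∫ x in seg α β, (x - t) ∂sourceLaw f = 0 ↔ t = centroid f α β := by
  rw [hf.setIntegral_sourceLaw _ (measurableSet_seg α β), hf.setIntegral_sub_mul h,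
    mul_eq_zero, or_iff_left (hf.mass_pos h).ne', sub_eq_zero, eq_comm]

/-- Positivity of `f` makes Lebesgue measure absolutely continuous with respect to the source law,
so almost sure statements can be tested in any nondegenerate segment. -/
theorem exists_mem_seg_of_ae {p : ℝ → Prop} (hp : ∀ᵐ x ∂sourceLaw f, p x) {α β : EReal}
    (h : α < β) : ∃ x ∈ seg α β, p x := by
  by_contra! hc
  exact (volume_seg_pos h).ne' (measure_mono_null (fun x hx => hc x hx)
    (hf.volume_absolutelyContinuous hp))

end LogConcaveWeight

end SourceLaw

section Edges

variable {N : ℕ} {m : ℕ → EReal}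

theorem exists_mem_seg (h0 : m 0 = ⊥) (hN : m N = ⊤) (x : ℝ) :
    ∃ k < N, x ∈ seg (m k) (m (k + 1)) := by
  classical
  have hex : ∃ k, (x : EReal) < m k := ⟨N, hN ▸ EReal.coe_lt_top x⟩
  have hle : Nat.find hex ≤ N := Nat.find_min' hex (hN ▸ EReal.coe_lt_top x)
  obtain ⟨k, hk⟩ : ∃ k, Nat.find hex = k + 1 := Nat.exists_eq_succ_of_ne_zero fun h => by
    have := Nat.find_spec hex
    rw [h, h0] at this
    exact not_lt_bot this
  refine ⟨k, by omega, not_lt.1 (Nat.find_min hex (by omega)), hk ▸ Nat.find_spec hex⟩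

theorem edge_le_edge (hlt : ∀ k < N, m k < m (k + 1)) {j k : ℕ} (hjk : j ≤ k) (hk : k ≤ N) :
    m j ≤ m k := by
  induction k, hjk using Nat.le_induction with
  | base => exact le_rfl
  | succ k _ ih => exact (ih (by omega)).trans (hlt k (by omega)).le

theorem index_le_of_mem_seg (hlt : ∀ k < N, m k < m (k + 1)) {x : ℝ} {j k : ℕ} (hj : j < N)
    (hxj : x ∈ seg (m j) (m (j + 1))) (hxk : x ∈ seg (m k) (m (k + 1))) : j ≤ k := by
  by_contra! h
  exact absurd (hxk.2.trans_le ((edge_le_edge hlt (Nat.succ_le_iff.2 h) hj.le).trans hxj.1))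
    (lt_irrefl _)

theorem index_unique_of_mem_seg (hlt : ∀ k < N, m k < m (k + 1)) {x : ℝ} {j k : ℕ} (hj : j < N)
    (hk : k < N) (hxj : x ∈ seg (m j) (m (j + 1))) (hxk : x ∈ seg (m k) (m (k + 1))) : j = k :=
  (index_le_of_mem_seg hlt hj hxj hxk).antisymm (index_le_of_mem_seg hlt hk hxk hxj)

/-- If the inner edges are midpoints shifted by `b`, the action of a bin costs the encoder at most
as much as the other actions. -/
theorem sq_le_sq_of_mem_seg {b : ℝ} {u : ℕ → ℝ} (hu : ∀ k, k + 1 < N → u k < u (k + 1))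
    (hm : ∀ k, k + 1 < N → m (k + 1) = ((((u k + u (k + 1)) / 2 + b : ℝ)) : EReal))
    {x : ℝ} {j k : ℕ} (hj : j < N) (hk : k < N) (hx : x ∈ seg (m k) (m (k + 1))) :
    (x - u k - b) ^ 2 ≤ (x - u j - b) ^ 2 := by
  have hmono : ∀ i l, i ≤ l → l < N → u i ≤ u l := by
    intro i l hil
    induction l, hil using Nat.le_induction with
    | base => exact fun _ => le_rfl
    | succ l _ ih => exact fun h => (ih (by omega)).trans (hu l h).le
  rcases lt_trichotomy j k with hjk | rfl | hjk
  · obtain ⟨i, rfl⟩ : ∃ i, k = i + 1 := ⟨k - 1, by omega⟩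
    have h1 := hx.1
    rw [hm i hk, EReal.coe_le_coe_iff] at h1
    have h2 := hmono j i (by omega) (by omega)
    have h3 := hu i hk
    nlinarith [mul_nonneg (show 0 ≤ u (i + 1) - u j by linarith)
      (show 0 ≤ x - ((u j + u (i + 1)) / 2 + b) by linarith)]
  · exact le_rfl
  · have h1 := hx.2
    rw [hm k (by omega), EReal.coe_lt_coe_iff] at h1
    have h2 := hmono (k + 1) j (by omega) (by omega)
    have h3 := hu k (by omega)
    nlinarith [mul_nonneg (show 0 ≤ u j - u k by linarith)
      (show 0 ≤ (u k + u j) / 2 + b - x by linarith)]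

end Edges

theorem IsBinChain.edge_eq {f : ℝ → ℝ} {b : ℝ} {N : ℕ} {m : ℕ → EReal} (h : IsBinChain f b N ⊤ m)
    {k : ℕ} (hk : k + 1 < N) : m (k + 1) = (((centroid f (m k) (m (k + 1)) +
      centroid f (m (k + 1)) (m (k + 2))) / 2 + b : ℝ) : EReal) := by
  rw [← h.indifferent k hk, mul_div_cancel_left₀ _ two_ne_zero, sub_add_cancel, h.coe_toReal hk]

/-- The real line is the disjoint union of the bins of a chain. -/
theorem lintegral_eq_sum_seg (P : Measure ℝ) {N : ℕ} {m : ℕ → EReal} (h0 : m 0 = ⊥) (hN : m N = ⊤)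
    (hlt : ∀ k < N, m k < m (k + 1)) (g : ℝ → ENNReal) :
    ∫⁻ x, g x ∂P = ∑ k ∈ Finset.range N, ∫⁻ x in seg (m k) (m (k + 1)), g x ∂P := by
  rw [← lintegral_biUnion_finset]
  · have : (⋃ k ∈ Finset.range N, seg (m k) (m (k + 1))) = Set.univ := by
      refine Set.eq_univ_of_forall fun x => ?_
      obtain ⟨k, hk, hx⟩ := exists_mem_seg h0 hN x
      exact Set.mem_biUnion (Finset.mem_coe.2 (Finset.mem_range.2 hk)) hx
    rw [this, Measure.restrict_univ]
  · intro j hj k hk hne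
    exact Set.disjoint_left.2 fun x hxj hxk => hne (index_unique_of_mem_seg hlt
      (Finset.mem_range.1 hj) (Finset.mem_range.1 hk) hxj hxk)
  · exact fun k _ => measurableSet_seg _ _

/-! ### Chains of bins and Nash equilibria -/

namespace LogConcaveWeight

variable {f : ℝ → ℝ} (hf : LogConcaveWeight f) [IsProbabilityMeasure (sourceLaw f)] {b : ℝ} {N : ℕ}
include hf

/-- The edges and the actions of a Nash equilibrium with bins. -/
theorem isBinChain_of_isNashEquilibrium {γe γd : ℝ → ℝ} {m : ℕ → EReal}
    (h : IsNashEquilibrium (sourceLaw f) b γe γd) (h0 : m 0 = ⊥) (hN : m N = ⊤)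
    (hlt : ∀ k < N, m k < m (k + 1))
    (hγe : ∀ k < N, ∀ x ∈ seg (m k) (m (k + 1)), γe x = (k : ℝ) + 1) :
    IsBinChain f b N ⊤ m ∧ ∀ k < N, γd ((k : ℝ) + 1) = centroid f (m k) (m (k + 1)) := by
  have hcen : ∀ k < N, γd ((k : ℝ) + 1) = centroid f (m k) (m (k + 1)) := by
    intro k hk
    rw [← hf.setIntegral_sub_eq_zero_iff (hlt k hk)]
    have hpre : γe ⁻¹' {(k : ℝ) + 1} = seg (m k) (m (k + 1)) := by
      ext x
      refine ⟨fun hx => ?_, hγe k hk x⟩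
      obtain ⟨j, hj, hxj⟩ := exists_mem_seg h0 hN x
      have hx' : γe x = (k : ℝ) + 1 := hx
      rw [hγe j hj x hxj, add_left_inj, Nat.cast_inj] at hx'
      rwa [← hx']
    have hz := h.decoder_setIntegral_eq_zero hf.memLp_two_sourceLaw
      (measurableSet_singleton ((k : ℝ) + 1))
    rw [hpre] at hz
    rw [← hz]
    exact setIntegral_congr_fun (measurableSet_seg _ _) fun x hx => by
      simp only [hγe k hk x hx]
  refine ⟨⟨h0, hN, hlt, fun k hk => ?_⟩, hcen⟩
  have hc := hcen k (by omega)
  have hc' := hcen (k + 1) hk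
  push_cast at hc'
  have hcc : centroid f (m k) (m (k + 1)) < centroid f (m (k + 1)) (m (k + 2)) :=
    hf.centroid_lt_centroid (hlt k (by omega)) (hlt (k + 1) hk)
  set u := centroid f (m k) (m (k + 1))
  set u' := centroid f (m (k + 1)) (m (k + 2))
  have hcoe : ((m (k + 1)).toReal : EReal) = m (k + 1) :=
    EReal.coe_toReal (hlt (k + 1) hk).ne_top (hlt k (by omega)).ne_bot
  have hl := h.encoder_ae_le hf.memLp_two_sourceLaw ((k : ℝ) + 1)
  have hr := h.encoder_ae_le hf.memLp_two_sourceLaw ((k : ℝ) + 1 + 1)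
  rw [hc] at hl
  rw [hc'] at hr
  have hlt1 := hlt k (by omega)
  have hlt2 := hlt (k + 1) hk
  have hγ1 := hγe k (by omega)
  have hγ2 := hγe (k + 1) hk
  push_cast at hγ2
  rw [← hcoe] at hlt1 hlt2 hγ1 hγ2
  set e := (m (k + 1)).toReal
  -- Otherwise a segment between `e` and the shifted midpoint would consist of observations for
  -- which the encoder strictly prefers the adjacent action.
  have key : e = (u + u') / 2 + b := by
    refine le_antisymm (not_lt.1 fun hlt => ?_) (not_lt.1 fun hlt => ?_)
    · obtain ⟨y, hy, hye⟩ := exists_between hlt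
      obtain ⟨x, hx, hx'⟩ := hf.exists_mem_seg_of_ae hr
        (max_lt hlt1 (EReal.coe_lt_coe_iff.2 hye))
      rw [hγ1 x ⟨(le_max_left _ _).trans hx.1, hx.2⟩, hc] at hx'
      have hyx : y ≤ x := EReal.coe_le_coe_iff.1 ((le_max_right _ _).trans hx.1)
      nlinarith [mul_pos (sub_pos.2 hcc) (show 0 < x - ((u + u') / 2 + b) by linarith)]
    · obtain ⟨x, hx, hx'⟩ := hf.exists_mem_seg_of_ae hl
        (lt_min hlt2 (EReal.coe_lt_coe_iff.2 hlt))
      rw [hγ2 x ⟨hx.1, hx.2.trans_le (min_le_left _ _)⟩, hc'] at hx'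
      have hyx : x < (u + u') / 2 + b :=
        EReal.coe_lt_coe_iff.1 (hx.2.trans_le (min_le_right _ _))
      nlinarith [mul_pos (sub_pos.2 hcc) (show 0 < (u + u') / 2 + b - x by linarith)]
  linarith

/-- Every chain of bins is supported by a Nash equilibrium. -/
theorem exists_isNashEquilibrium {m : ℕ → EReal} (h : IsBinChain f b N ⊤ m) :
    ∃ γe γd : ℝ → ℝ, IsNashEquilibrium (sourceLaw f) b γe γd ∧
      (∀ k < N, ∀ x ∈ seg (m k) (m (k + 1)), γe x = (k : ℝ) + 1) ∧
      ∀ k < N, γd ((k : ℝ) + 1) = centroid f (m k) (m (k + 1)) := by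
  set u : ℕ → ℝ := fun k => centroid f (m k) (m (k + 1)) with hu
  have hNpos : 0 < N := Nat.pos_of_ne_zero fun h0 => by
    have := h.last
    rw [h0, h.first] at this
    exact bot_ne_top this
  set γe : ℝ → ℝ := fun x => ∑ k ∈ Finset.range N,
    (seg (m k) (m (k + 1))).indicator (fun _ => (k : ℝ) + 1) x with hγe
  -- Every message, used or not, is answered by one of the actions `u j`, so no encoder deviation
  -- reaches a new action. Truncated subtraction sends messages below `1` to `u 0`.
  set γd : ℝ → ℝ := fun y => if ⌊y⌋₊ - 1 < N then u (⌊y⌋₊ - 1) else u 0 with hγd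
  have he : ∀ k < N, ∀ x ∈ seg (m k) (m (k + 1)), γe x = (k : ℝ) + 1 := by
    intro k hk x hx
    simp only [hγe]
    rw [Finset.sum_eq_single k]
    · rw [Set.indicator_of_mem hx]
    · intro j hj hjk
      refine Set.indicator_of_notMem (fun hxj => hjk ?_) _
      exact index_unique_of_mem_seg h.lt_succ (Finset.mem_range.1 hj) hk hxj hx
    · exact fun hk' => absurd (Finset.mem_range.2 hk) hk'
  have hd : ∀ k < N, γd ((k : ℝ) + 1) = u k := by
    intro k hk
    have : ⌊(k : ℝ) + 1⌋₊ = k + 1 := by exact_mod_cast Nat.floor_natCast (R := ℝ) (k + 1)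
    simp only [hγd, this, Nat.add_sub_cancel, if_pos hk]
  have hrange : ∀ y, ∃ j < N, γd y = u j := by
    intro y
    by_cases hy : ⌊y⌋₊ - 1 < N
    · exact ⟨_, hy, if_pos hy⟩
    · exact ⟨0, hNpos, if_neg hy⟩
  have hmono : ∀ k, k + 1 < N → u k < u (k + 1) := fun k hk =>
    hf.centroid_lt_centroid (h.lt_succ k (by omega)) (h.lt_succ (k + 1) hk)
  have hmid : ∀ k, k + 1 < N → m (k + 1) = ((((u k + u (k + 1)) / 2 + b : ℝ)) : EReal) :=
    fun k hk => h.edge_eq hk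
  refine ⟨γe, γd, ⟨?_, ?_, fun γ _ => ?_, fun γ _ => ?_⟩, he, hd⟩
  · exact Finset.measurable_sum _ fun k _ => measurable_const.indicator (measurableSet_seg _ _)
  · exact (measurable_from_nat (f := fun n : ℕ => if n - 1 < N then u (n - 1) else u 0)).comp
      Nat.measurable_floor
  · refine lintegral_mono fun x => ENNReal.ofReal_le_ofReal ?_
    obtain ⟨k, hk, hx⟩ := exists_mem_seg h.first h.last x
    obtain ⟨j, hj, hγ⟩ := hrange (γ x)
    rw [he k hk x hx, hd k hk, hγ]
    exact sq_le_sq_of_mem_seg (u := u) hmono hmid hj hk hx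
  · rw [decoderCost, decoderCost, lintegral_eq_sum_seg _ h.first h.last h.lt_succ,
      lintegral_eq_sum_seg _ h.first h.last h.lt_succ]
    refine Finset.sum_le_sum fun k hk => ?_
    have hk := Finset.mem_range.1 hk
    have h1 : ∫⁻ x in seg (m k) (m (k + 1)), ENNReal.ofReal ((x - γd (γe x)) ^ 2) ∂sourceLaw f =
        ∫⁻ x in seg (m k) (m (k + 1)), ENNReal.ofReal ((x - u k) ^ 2) ∂sourceLaw f :=
      setLIntegral_congr_fun (measurableSet_seg _ _) fun x hx => by
        rw [he k hk x hx, hd k hk]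
    have h2 : ∫⁻ x in seg (m k) (m (k + 1)), ENNReal.ofReal ((x - γ (γe x)) ^ 2) ∂sourceLaw f =
        ∫⁻ x in seg (m k) (m (k + 1)), ENNReal.ofReal ((x - γ ((k : ℝ) + 1)) ^ 2) ∂sourceLaw f :=
      setLIntegral_congr_fun (measurableSet_seg _ _) fun x hx => by
        rw [he k hk x hx]
    rw [h1, h2]
    exact setLIntegral_sub_sq_le hf.memLp_two_sourceLaw
      ((hf.setIntegral_sub_eq_zero_iff (h.lt_succ k hk) _).2 rfl) _

/-- A Nash equilibrium with finitely many actions leads almost surely to the decisions of a chain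
of bins. -/
theorem exists_isBinChain_of_inducesActions {γe γd : ℝ → ℝ}
    (h : IsNashEquilibrium (sourceLaw f) b γe γd) (hA : InducesActions (sourceLaw f) γe γd N) :
    ∃ m, IsBinChain f b N ⊤ m ∧ ∀ᵐ x ∂sourceLaw f, ∀ k < N, x ∈ seg (m k) (m (k + 1)) →
      γd (γe x) = centroid f (m k) (m (k + 1)) := by
  obtain ⟨A, hcard, hmem, hpos⟩ := hA
  set a : ℕ → ℝ := fun k => if hk : k < N then A.orderEmbOfFin hcard ⟨k, hk⟩ else 0 with ha
  have ha_mem : ∀ k < N, a k ∈ A := fun k hk => by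
    simp only [ha, dif_pos hk]
    exact A.orderEmbOfFin_mem hcard _
  have ha_surj : ∀ y ∈ A, ∃ k < N, a k = y := by
    intro y hy
    have : y ∈ Set.range (A.orderEmbOfFin hcard) := by rwa [A.range_orderEmbOfFin hcard]
    obtain ⟨k, rfl⟩ := this
    exact ⟨k, k.2, dif_pos k.2⟩
  have ha_lt : ∀ j k, j < k → k < N → a j < a k := by
    intro j k hjk hk
    simp only [ha, dif_pos hk, dif_pos (hjk.trans hk)]
    exact (A.orderEmbOfFin hcard).strictMono hjk
  have hNpos : 0 < N := by
    obtain ⟨x, hx⟩ := hmem.exists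
    obtain ⟨k, hk, -⟩ := ha_surj _ hx
    omega
  -- With the actions listed in increasing order, the edges are the midpoints of neighbours shifted
  -- by `b`: the points where the nearest action to `x - b` changes.
  set m : ℕ → EReal := fun k => if k = 0 then ⊥ else if k < N then
    (((a (k - 1) + a k) / 2 + b : ℝ) : EReal) else ⊤ with hm
  have hm0 : m 0 = ⊥ := if_pos rfl
  have hmN : m N = ⊤ := by simp [hm, hNpos.ne']
  have hms : ∀ k, k + 1 < N → m (k + 1) = (((a k + a (k + 1)) / 2 + b : ℝ) : EReal) := by
    intro k hk
    simp [hm, hk]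
  have hlt : ∀ k < N, m k < m (k + 1) := by
    intro k hk
    rcases (Nat.succ_le_iff.2 hk).eq_or_lt with hkN | hkN
    · rw [show k + 1 = N from hkN, hmN]
      rcases k.eq_zero_or_pos with rfl | hk0
      · rw [hm0]; exact bot_lt_top
      · obtain ⟨i, rfl⟩ : ∃ i, k = i + 1 := ⟨k - 1, by omega⟩
        rw [hms i hk]; exact EReal.coe_lt_top _
    · rw [hms k hkN]
      rcases k.eq_zero_or_pos with rfl | hk0
      · rw [hm0]; exact EReal.bot_lt_coe _
      · obtain ⟨i, rfl⟩ : ∃ i, k = i + 1 := ⟨k - 1, by omega⟩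
        rw [hms i hk, EReal.coe_lt_coe_iff]
        linarith [ha_lt i (i + 1) (by omega) hk, ha_lt (i + 1) (i + 1 + 1) (by omega) hkN]
  have hmsg : ∀ k < N, ∃ y, γd y = a k := by
    intro k hk
    obtain ⟨x, hx⟩ := nonempty_of_measure_ne_zero (hpos _ (ha_mem k hk)).ne'
    exact ⟨γe x, hx⟩
  have hbest : ∀ᵐ x ∂sourceLaw f, ∀ k < N, (x - γd (γe x) - b) ^ 2 ≤ (x - a k - b) ^ 2 := by
    rw [ae_all_iff]
    intro k
    by_cases hk : k < N
    · obtain ⟨y, hy⟩ := hmsg k hk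
      filter_upwards [h.encoder_ae_le hf.memLp_two_sourceLaw y] with x hx _
      rwa [hy] at hx
    · exact Filter.Eventually.of_forall fun x hk' => absurd hk' hk
  -- At an edge two actions tie, and either may be taken; the edges form a null set.
  have hedge : ∀ᵐ x ∂sourceLaw f, x ∉ Set.range fun k => (m k).toReal :=
    (withDensity_absolutelyContinuous _ _).ae_le
      ((Set.countable_range _).ae_notMem volume)
  have hval : ∀ᵐ x ∂sourceLaw f, ∀ k < N, x ∈ seg (m k) (m (k + 1)) → γd (γe x) = a k := by
    filter_upwards [hmem, hbest, hedge] with x hxA hxb hxe k hk hx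
    obtain ⟨j, hj, hjx⟩ := ha_surj _ hxA
    have hle := hxb k hk
    rw [← hjx] at hle ⊢
    rcases lt_trichotomy j k with hjk | rfl | hjk
    · exfalso
      obtain ⟨i, rfl⟩ : ∃ i, k = i + 1 := ⟨k - 1, by omega⟩
      have h1 := hx.1
      rw [hms i hk, EReal.coe_le_coe_iff] at h1
      have h2 : (a i + a (i + 1)) / 2 + b ≠ x := fun heq => hxe ⟨i + 1, by
        simp only [hms i hk, EReal.toReal_coe, heq]⟩
      have h3 : a j ≤ a i := by
        rcases (Nat.lt_succ_iff.1 hjk).eq_or_lt with rfl | hji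
        · rfl
        · exact (ha_lt j i hji (by omega)).le
      have h4 := ha_lt j (i + 1) hjk hk
      have h5 := lt_of_le_of_ne h1 h2
      nlinarith [mul_pos (sub_pos.2 h4)
        (show 0 < x - ((a j + a (i + 1)) / 2 + b) by linarith)]
    · rfl
    · exfalso
      have h1 := hx.2
      rw [hms k (by omega), EReal.coe_lt_coe_iff] at h1
      have h3 : a (k + 1) ≤ a j := by
        rcases (Nat.succ_le_iff.2 hjk).eq_or_lt with hji | hji
        · exact (congrArg a hji).le
        · exact (ha_lt (k + 1) j hji hj).le
      have h4 := ha_lt k j hjk hj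
      nlinarith [mul_pos (sub_pos.2 h4)
        (show 0 < (a k + a j) / 2 + b - x by linarith)]
  have hcen : ∀ k < N, a k = centroid f (m k) (m (k + 1)) := by
    intro k hk
    rw [← hf.setIntegral_sub_eq_zero_iff (hlt k hk)]
    -- Several messages may lead to `a k`; unbiasedness is applied to all of them together, whose
    -- preimage is almost surely the bin.
    have hmeas := h.measurable_decoder (measurableSet_singleton (a k))
    have hz := h.decoder_setIntegral_eq_zero hf.memLp_two_sourceLaw hmeas
    have hset : γe ⁻¹' (γd ⁻¹' {a k}) =ᵐ[sourceLaw f] seg (m k) (m (k + 1)) := by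
      filter_upwards [hval] with x hx
      refine propext ⟨fun hxk => ?_, hx k hk⟩
      obtain ⟨j, hj, hxj⟩ := exists_mem_seg hm0 hmN x
      have hjk : a j = a k := (hx j hj hxj).symm.trans hxk
      have : j = k := by
        rcases lt_trichotomy j k with hlt' | heq | hlt'
        · exact absurd hjk (ha_lt j k hlt' hk).ne
        · exact heq
        · exact absurd hjk (ha_lt k j hlt' hj).ne'
      exact this ▸ hxj
    rw [← setIntegral_congr_set hset, ← hz]
    exact setIntegral_congr_fun (h.measurable_encoder hmeas) fun x hx => by
      have : γd (γe x) = a k := hx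
      simp only [this]
  refine ⟨m, ⟨hm0, hmN, hlt, fun k hk => ?_⟩, ?_⟩
  · rw [hms k hk, EReal.toReal_coe, ← hms k hk, ← hcen k (by omega), ← hcen (k + 1) hk]
    ring
  · filter_upwards [hval] with x hx k hk hxk
    rw [← hcen k hk]
    exact hx k hk hxk

end LogConcaveWeight

/-! ### Transfer to edges indexed by `Fin` and conclusion -/

/-- Edges indexed by `Fin (N + 1)`, extended by `+∞`. -/
noncomputable def extendEdges {N : ℕ} (m : Fin (N + 1) → EReal) (k : ℕ) : EReal :=
  if h : k < N + 1 then m ⟨k, h⟩ else ⊤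

theorem extendEdges_of_le {N : ℕ} (m : Fin (N + 1) → EReal) {k : ℕ} (h : k ≤ N) :
    extendEdges m k = m ⟨k, Nat.lt_succ_of_le h⟩ := dif_pos _

theorem bin_eq_seg {N : ℕ} (m : Fin (N + 1) → EReal) (k : Fin N) :
    bin m k = seg (extendEdges m k) (extendEdges m (k + 1)) := by
  rw [extendEdges_of_le m k.2.le, extendEdges_of_le m k.2]
  rfl

theorem IsEquilibriumWithBins.isBinChain {f : ℝ → ℝ} (hf : LogConcaveWeight f)
    [IsProbabilityMeasure (sourceLaw f)] {b : ℝ} {N : ℕ} {m : Fin (N + 1) → EReal} {u : Fin N → ℝ}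
    (h : IsEquilibriumWithBins (sourceLaw f) b m u) :
    IsBinChain f b N ⊤ (extendEdges m) ∧
      ∀ k : Fin N, u k = centroid f (extendEdges m k) (extendEdges m (k + 1)) := by
  obtain ⟨γe, γd, hNash, hγe, hγd⟩ := h.exists_policies
  obtain ⟨h1, h2⟩ := hf.isBinChain_of_isNashEquilibrium (m := extendEdges m) (N := N) hNash
    ((extendEdges_of_le m (Nat.zero_le N)).trans h.first_edge)
    ((extendEdges_of_le m le_rfl).trans h.last_edge)
    (fun k hk => by
      rw [extendEdges_of_le m hk.le, extendEdges_of_le m hk]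
      exact h.strictMono_edges (Nat.lt_succ_self k))
    (fun k hk x hx => hγe ⟨k, hk⟩ x (by rwa [bin_eq_seg]))
  exact ⟨h1, fun k => (hγd k).symm.trans (h2 k k.2)⟩

theorem IsEquilibriumWithBins.pos {P : Measure ℝ} {b : ℝ} {N : ℕ} {m : Fin (N + 1) → EReal}
    {u : Fin N → ℝ} (h : IsEquilibriumWithBins P b m u) : 1 ≤ N := by
  by_contra! hN
  obtain rfl : N = 0 := by omega
  exact bot_ne_top (h.first_edge.symm.trans h.last_edge)

theorem existsUnique_isEquilibriumWithBins {f : ℝ → ℝ} (hf : LogConcaveWeight f)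
    [IsProbabilityMeasure (sourceLaw f)] (b : ℝ) {N : ℕ} (hN : 1 ≤ N) :
    ∃! p : (Fin (N + 1) → EReal) × (Fin N → ℝ),
      IsEquilibriumWithBins (sourceLaw f) b p.1 p.2 := by
  obtain ⟨m, hm⟩ := hf.exists_binChain b hN
  obtain ⟨γe, γd, hNash, hγe, hγd⟩ := hf.exists_isNashEquilibrium hm
  refine ⟨(fun k => m k, fun k => centroid f (m k) (m (k + 1))), ⟨hm.first, hm.last,
    Fin.strictMono_iff_lt_succ.2 fun k => hm.lt_succ k k.2,
    γe, γd, hNash, fun k x hx => hγe k k.2 x hx, fun k => hγd k k.2⟩, ?_⟩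
  rintro ⟨m', u'⟩ h'
  obtain ⟨hm', hu'⟩ := h'.isBinChain hf
  have heq := hf.binChain_unique hN hm' hm
  refine Prod.ext (funext fun k => ?_) (funext fun k => ?_)
  · have := heq k (Nat.lt_succ_iff.1 k.2)
    rwa [extendEdges_of_le _ (Nat.lt_succ_iff.1 k.2)] at this
  · refine (hu' k).trans ?_
    rw [heq k k.2.le, heq (k + 1) k.2]

end CheapTalk

theorem theorem3 (f : ℝ → ℝ) (hf : CheapTalk.IsProbabilityDensity f)
    (hlog : CheapTalk.IsLogConcaveDensity f)
    (hsupp : CheapTalk.HasTwoSidedUnboundedSupport f)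
    (hmean : CheapTalk.HasFiniteMean f) (b : ℝ) :
    -- for every number of bins there is exactly one equilibrium
    (∀ N : ℕ, 1 ≤ N →
      ∃! p : (Fin (N + 1) → EReal) × (Fin N → ℝ),
        CheapTalk.IsEquilibriumWithBins (CheapTalk.sourceLaw f) b p.1 p.2) ∧
    -- every Nash equilibrium, in arbitrary policies, with `N` different actions leads almost
    -- surely to the same decisions as the equilibrium with `N` bins
    (∀ N : ℕ, ∀ m : Fin (N + 1) → EReal, ∀ u : Fin N → ℝ,
      CheapTalk.IsEquilibriumWithBins (CheapTalk.sourceLaw f) b m u →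
      ∀ γe γd : ℝ → ℝ, CheapTalk.IsNashEquilibrium (CheapTalk.sourceLaw f) b γe γd →
        CheapTalk.InducesActions (CheapTalk.sourceLaw f) γe γd N →
        ∀ᵐ x ∂(CheapTalk.sourceLaw f), ∀ k : Fin N, x ∈ CheapTalk.bin m k → γd (γe x) = u k) ∧
    -- there is no upper bound on the number of bins
    ¬ ∃ K : ℕ, ∀ N : ℕ, ∀ m : Fin (N + 1) → EReal, ∀ u : Fin N → ℝ,
      CheapTalk.IsEquilibriumWithBins (CheapTalk.sourceLaw f) b m u → N ≤ K := by
  have hw := CheapTalk.logConcaveWeight hf hlog hsupp hmean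
  have := hf.isProbabilityMeasure
  refine ⟨fun N hN => CheapTalk.existsUnique_isEquilibriumWithBins hw b hN, ?_, ?_⟩
  · intro N m u hmu γe γd hNash hA
    obtain ⟨hm, hu⟩ := hmu.isBinChain hw
    obtain ⟨m', hm', hval⟩ := hw.exists_isBinChain_of_inducesActions hNash hA
    have heq := hw.binChain_unique hmu.pos hm hm'
    filter_upwards [hval] with x hx k hxk
    rw [CheapTalk.bin_eq_seg] at hxk
    rw [hu k]
    rw [heq k k.2.le, heq (k + 1) k.2] at hxk ⊢
    exact hx k k.2 hxk
  · rintro ⟨K, hK⟩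
    obtain ⟨p, hp, -⟩ := CheapTalk.existsUnique_isEquilibriumWithBins hw b (Nat.le_add_left 1 K)
    exact absurd (hK _ _ _ hp) (by omega)
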